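/- For $r\ge 0$ let $$\zeta_{EZ,r}(s_1,\dots,s_r)=\sum_{1\le m_1<\cdots<m_r}m_1^{-s_1}\cdots m_r^{-s_r},\qquad \zeta^{\star}_{EZ,r}(s_1,\dots,s_r)=\sum_{1\le m_1\le\cdots\le m_r}m_1^{-s_1}\cdots m_r^{-s_r},$$ both equal to $1$ for $r=0$. Both series converge absolutely for $\Re(s_j+\cdots+s_r)>r-j+1$ $(1\le j\le r)$, and both functions have a meromorphic continuation to $\mathbb C^r$, denoted by the same symbols. Let $k,\ell\ge 1$ and let $\theta=\mathrm{rib}(k|\ell)=\lambda/\mu$ be the anti-hook skew diagram with $\lambda=(k+1,\dots,k+1)$ ($\ell+1$ rows) and $\mu=(k,\dots,k)$ ($\ell$ rows), so that $|\theta|=k+\ell+1$. Let $\boldsymbol s\in\mathbb C^{k+\ell+1}$ be the tableau of shape $\theta$ with bottom row $s_{00},s_{10},\dots,s_{k0}$ from left to right and right column $s_{k0},s_{k1},\dots,s_{k\ell}$ from bottom to top. Let $\boldsymbol s'$ be the transposed tableau, of the transposed shape $\theta'$. For a tableau $T=(t_{ij})$ of skew shape $\kappa$ with $n$ boxes, $i$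 being the row and $j$ the column, whose entries are regarded as independent variables, write $\boldsymbol t\preceq T$ for a tuple $\boldsymbol t=(t_1,\dots,t_m)$ of sums of these variables if the following holds. There are a bijection $f:\kappa\to\{1,\dots,n\}$ that is strictly increasing along rows (left to right) and down columns, with associated word $(v_1,\dots,v_n)=(t_{f^{-1}(1)},\dots,t_{f^{-1}(n)})$, and a partition of $\{1,\dots,n\}$ into intervals $I_1,\dots,I_m$, nonempty and taken in increasing order, such that $t_a=\sum_{h\in I_a}v_h$ and such that no $f^{-1}(I_a)$ contains two boxes of the same column. Each such formal tuple is counted once, and is then evaluated at the given complex values. Put $\mathrm{length}(\boldsymbol t)=m$. Then the following identities of meromorphic functions of $\boldsymbol s$ on $\mathbb C^{k+\ell+1}$ hold; that is, each identity holds at every $\boldsymbol s$ at which all the functions $\zeta_{EZ}$, $\zeta^\star_{EZ}$ occurring in it are holomorphic at their arguments: $$\sum_{\boldsymbol t\preceq\boldsymbol s}\zeta_{EZ,\mathrm{length}(\boldsymbol t)}(\boldsymbol t)=\sum_{i=0}^{k}(-1)^{k-i}\zeta^{\star}_{EZ,i}(s_{00},s_{10},\dots,s_{i-1,0})\,\zeta_{EZ,\ell+k-i+1}(s_{k\ell},s_{k,\ell-1},\dots,s_{k0},s_{k-1,0},\dots,s_{i0}),$$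 $$\sum_{\boldsymbol t\preceq\boldsymbol s'}(-1)^{|\theta|-\mathrm{length}(\boldsymbol t)}\zeta^{\star}_{EZ,\mathrm{length}(\boldsymbol t)}(\boldsymbol t)=\sum_{i=0}^{k}(-1)^{k-i}\zeta^{\star}_{EZ,i}(s_{00},s_{10},\dots,s_{i-1,0})\,\zeta_{EZ,\ell+k-i+1}(s_{k\ell},s_{k,\ell-1},\dots,s_{k0},s_{k-1,0},\dots,s_{i0}).$$ -/

import Mathlib

namespace SchurZeta

/-! ### Meromorphic functions of several complex variables and their continuation -/

/-- `F` is meromorphic on the whole space `ℂ^r`: near every point it is a quotient `g / h` of two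
holomorphic functions, where `h` does not vanish identically near that point. The values of `F`
on the zeros of `h` are not restricted. -/
def IsMeromorphic {r : ℕ} (F : (Fin r → ℂ) → ℂ) : Prop :=
  ∀ p : Fin r → ℂ, ∃ g h : (Fin r → ℂ) → ℂ,
    AnalyticAt ℂ g p ∧ AnalyticAt ℂ h p ∧ (¬ ∀ᶠ z in nhds p, h z = 0) ∧
      ∀ᶠ z in nhds p, h z ≠ 0 → F z = g z / h z

/-- `F` is a meromorphic continuation to `ℂ^r` of the function `f` given on `D`. -/
def IsMeromorphicContinuation {r : ℕ} (D : Set (Fin r → ℂ)) (f F : (Fin r → ℂ) → ℂ) : Prop :=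
  IsMeromorphic F ∧ Set.EqOn F f D

open Classical in
/-- The meromorphic continuation of `f` from `D` to `ℂ^r`. At a point where some continuation is
holomorphic, this is the value of such a continuation; at the other points (the singularities) the
value is set to `0`. When `D` is open and nonempty the value does not depend on the choice made,
by the identity theorem. -/
noncomputable def continuation {r : ℕ} (D : Set (Fin r → ℂ)) (f : (Fin r → ℂ) → ℂ)
    (p : Fin r → ℂ) : ℂ :=
  if h : ∃ F : (Fin r → ℂ) → ℂ, IsMeromorphicContinuation D f F ∧ AnalyticAt ℂ F p then
    h.choose p
  else 0

/-! ### Euler-Zagier multiple zeta-functions -/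

/-- The term `m₁^{-s₁} ⋯ m_r^{-s_r}`. -/
noncomputable def term {r : ℕ} (s : Fin r → ℂ) (m : Fin r → ℕ+) : ℂ :=
  ∏ i, ((m i : ℕ) : ℂ) ^ (-(s i))

/-- The domain of absolute convergence, `Re (s_j + ⋯ + s_r) > r - j + 1` for `1 ≤ j ≤ r`
(here `j` is counted from `0`). -/
def convDomain (r : ℕ) : Set (Fin r → ℂ) :=
  {s | ∀ j : Fin r, ((r - (j : ℕ) : ℕ) : ℝ) < ∑ i ∈ Finset.Ici j, (s i).re}

/-- The series over `1 ≤ m₁ < ⋯ < m_r`; it is `1` for `r = 0`. -/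
noncomputable def ezSeries (r : ℕ) (s : Fin r → ℂ) : ℂ :=
  ∑' m : {m : Fin r → ℕ+ // StrictMono m}, term s m.1

/-- The series over `1 ≤ m₁ ≤ ⋯ ≤ m_r`; it is `1` for `r = 0`. -/
noncomputable def ezStarSeries (r : ℕ) (s : Fin r → ℂ) : ℂ :=
  ∑' m : {m : Fin r → ℕ+ // Monotone m}, term s m.1

/-- The Euler-Zagier multiple zeta-function on `ℂ^r`, by meromorphic continuation. -/
noncomputable def zetaEZ (r : ℕ) : (Fin r → ℂ) → ℂ :=
  continuation (convDomain r) (ezSeries r)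

/-- The star variant of the Euler-Zagier multiple zeta-function on `ℂ^r`, by meromorphic
continuation. -/
noncomputable def zetaEZStar (r : ℕ) : (Fin r → ℂ) → ℂ :=
  continuation (convDomain r) (ezStarSeries r)

/-! ### Diagrams, tableaux and the relation `t ≼ T`

A diagram is a finite set of boxes `(i, j)`, `i` being the row (counted downwards) and `j` the
column, and a tableau over `X` of shape `θ` is a function `θ → X`. -/

/-- The set `𝓕(θ)`: bijections of `θ` with `{0, …, |θ| - 1}` that increase along rows and down
columns. -/
def IsStandard (θ : Finset (ℕ × ℕ)) (f : θ ≃ Fin θ.card) : Prop :=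
  (∀ c d : θ, c.1.1 = d.1.1 → (f c < f d ↔ c.1.2 < d.1.2)) ∧
  (∀ c d : θ, c.1.2 = d.1.2 → (f c < f d ↔ c.1.1 < d.1.1))

/-- The relation `w ≼ T` for the tableau `T` of shape `θ` whose entries are independent variables.
A sum of distinct variables is recorded as the set of boxes in which these variables stand:
`w a` is the set of the boxes of the consecutive variables
`v_{h a}, v_{h a + 1}, …, v_{h a + l a}` of the word `v = (t_{f⁻¹(0)}, t_{f⁻¹(1)}, …)`. -/
def Preceq (θ : Finset (ℕ × ℕ)) (m : ℕ) (w : Fin m → Finset θ) : Prop :=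
  ∃ f : θ ≃ Fin θ.card, IsStandard θ f ∧
    ∃ h l : Fin m → ℕ, StrictMono h ∧
      (∀ a : Fin m, ∀ c : θ, c ∈ w a ↔ h a ≤ (f c : ℕ) ∧ (f c : ℕ) ≤ h a + l a) ∧
      (∀ a : Fin m, ¬ ∃ c ∈ w a, ∃ d ∈ w a, c.1.1 ≠ d.1.1 ∧ c.1.2 = d.1.2) ∧
      Pairwise (fun a b : Fin m =>
        Disjoint (Finset.Icc (h a) (h a + l a)) (Finset.Icc (h b) (h b + l b))) ∧
      Finset.univ.biUnion (fun a : Fin m => Finset.Icc (h a) (h a + l a)) = Finset.range θ.card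

/-- The tuple of complex numbers got from the tuple `w` of sums of variables by giving the variable
in the box `c` the value `s c`. -/
def blockSums {θ : Finset (ℕ × ℕ)} (s : θ → ℂ) {m : ℕ} (w : Fin m → Finset θ) : Fin m → ℂ :=
  fun a => ∑ c ∈ w a, s c

open Classical in
/-- The sum over all `t ≼ s` of `φ (length t) t`. The length of `t` never exceeds `|θ|`. -/
noncomputable def sumPreceq {θ : Finset (ℕ × ℕ)} (s : θ → ℂ) (φ : (m : ℕ) → (Fin m → ℂ) → ℂ) : ℂ :=
  ∑ m ∈ Finset.range (θ.card + 1),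
    ∑ w : Fin m → Finset θ with Preceq θ m w, φ m (blockSums s w)

/-- The transpose of a diagram. -/
def transposeDiagram (θ : Finset (ℕ × ℕ)) : Finset (ℕ × ℕ) :=
  θ.map (Equiv.prodComm ℕ ℕ).toEmbedding

/-- The transpose of a tableau. -/
def transpose {θ : Finset (ℕ × ℕ)} (s : θ → ℂ) : transposeDiagram θ → ℂ :=
  fun c => s ⟨c.1.swap, by
    obtain ⟨c, hc⟩ := c
    obtain ⟨d, hd, rfl⟩ := Finset.mem_map.1 hc
    simpa using hd⟩

/-! ### The anti-hook `rib(k | ℓ)` -/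

/-- The skew diagram `rib(k | ℓ) = λ / μ` with `λ = (k + 1, …, k + 1)` (`ℓ + 1` rows) and
`μ = (k, …, k)` (`ℓ` rows); rows and columns are counted from `0`. -/
def antiHook (k ℓ : ℕ) : Finset (ℕ × ℕ) :=
  (Finset.range (ℓ + 1) ×ˢ Finset.range (k + 1)) \ (Finset.range ℓ ×ˢ Finset.range k)

/-- The entry `s_{p0}` of the bottom row, `0 ≤ p ≤ k`, from left to right. -/
def rowEntry {k ℓ : ℕ} (s : antiHook k ℓ → ℂ) (p : Fin (k + 1)) : ℂ :=
  s ⟨(ℓ, p), by simp [antiHook]; omega⟩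

/-- The entry `s_{kq}` of the right column, `0 ≤ q ≤ ℓ`, from bottom to top. -/
def colEntry {k ℓ : ℕ} (s : antiHook k ℓ → ℂ) (q : Fin (ℓ + 1)) : ℂ :=
  s ⟨(ℓ - q, k), by simp [antiHook]⟩

/-- The tuple `(s_{00}, s_{10}, …, s_{i-1,0})`. -/
def starArg {k ℓ : ℕ} (s : antiHook k ℓ → ℂ) (i : Fin (k + 1)) : Fin (i : ℕ) → ℂ :=
  fun a => rowEntry s ⟨a, by omega⟩

/-- The tuple `(s_{kℓ}, s_{k,ℓ-1}, …, s_{k0}, s_{k-1,0}, …, s_{i0})`. -/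
def ezArg {k ℓ : ℕ} (s : antiHook k ℓ → ℂ) (i : Fin (k + 1)) : Fin (ℓ + k - i + 1) → ℂ :=
  fun a =>
    if h : (a : ℕ) ≤ ℓ then colEntry s ⟨ℓ - a, by omega⟩
    else rowEntry s ⟨k + ℓ - a, by omega⟩

/-- The sum
`Σ_{i=0}^k (-1)^{k-i} ζ*_{EZ,i}(s_{00}, …, s_{i-1,0}) ζ_{EZ,ℓ+k-i+1}(s_{kℓ}, …, s_{k0}, …, s_{i0})`. -/
noncomputable def antiHookSum {k ℓ : ℕ} (s : antiHook k ℓ → ℂ) : ℂ :=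
  ∑ i : Fin (k + 1), (-1) ^ (k - (i : ℕ)) *
    zetaEZStar i (starArg s i) * zetaEZ (ℓ + k - i + 1) (ezArg s i)

/-- None of the functions in `antiHookSum` is singular at `s`. -/
def AntiHookSumRegular {k ℓ : ℕ} (s : antiHook k ℓ → ℂ) : Prop :=
  ∀ i : Fin (k + 1), AnalyticAt ℂ (zetaEZStar i) (starArg s i) ∧
    AnalyticAt ℂ (zetaEZ (ℓ + k - i + 1)) (ezArg s i)

end SchurZeta

/-! ### Holomorphic functions of several variables -/

namespace SchurZeta

open Metric Set Filter Topology

/-! Where every entry has real part above 2, both sides converge absolutely and become sums over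
fillings `g` of the diagram by positive integers, with weight `fillTerm s g`. A tuple `t ≼ s`
amounts to an ordered set partition of the boxes whose block index increases weakly along rows and
strictly down columns (`Preceq.exists_blockIndex`, `preceq_of_blockIndex`). Its zeta value runs over
the fillings constant on each block, with strictly (for the star version weakly) increasing block
values. After exchanging sums (`sumPreceq_eq_tsum`) there remains, for each `g`, a weighted count of
the compatible ordered partitions. In the strict case the blocks must be the level sets of `g`, so
the count is the indicator of semistandard fillings (`sum_compatible_one`). In the weak, signed case
a sign-reversing involution on first blocks shows that the count is the indicator of strict rows and
weak columns (`sum_compatible_zero`), and transposition turns this into the semistandard condition.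

On the right, the `i`-th product sums over fillings that increase weakly on the first `i` boxes of
the row and decrease strictly along the rest of the path through row and column. The comparison
across the cut is free; splitting according to it makes the alternating sum telescope to the
semistandard fillings (`sum_splitAt`, `antiHookSum_eq_tsum`).

To reach all of the space, `exists_entire_gammaFactor_mul` shows that each series times a product of
reciprocal Gamma values extends to an entire function: a telescoping sum over the last variable
expresses the series through one of smaller depth, its own shifts to the right, and a remainder that
converges further to the left. Holomorphy of the series involved rests on an Osgood lemma,
`analyticAt_of_continuousOn_of_separately`. By `mul_eq_of_isMeromorphicContinuation` the
continuation does not depend on choices, so the difference of the two sides is a quotient of entire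
functions vanishing on an open set. By `IsEntireQuotient.eq_zero` it vanishes wherever it is
continuous. -/

theorem differentiableAt_of_forall_eval {K F : Type} [TopologicalSpace K] [CompactSpace K]
    [NormedAddCommGroup F] [NormedSpace ℂ F] [CompleteSpace F] {ψ : ℂ → C(K, F)} {c : ℂ} {R : ℝ}
    (hR : 0 < R) (hc : ContinuousOn ψ (ball c R))
    (hd : ∀ x : K, DifferentiableOn ℂ (fun t => ψ t x) (ball c R)) :
    DifferentiableAt ℂ ψ c := by
  set η : NNReal := ⟨R / 2, by positivity⟩ with hη
  have hη0 : 0 < η := by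
    rw [← NNReal.coe_pos]; change 0 < R / 2; positivity
  have hsub : closedBall c (η : ℝ) ⊆ ball c R := by
    intro z hz
    rw [mem_closedBall] at hz
    rw [mem_ball]
    have : (η : ℝ) = R / 2 := rfl
    linarith
  have hci : CircleIntegrable ψ c η :=
    (hc.mono (sphere_subset_closedBall.trans hsub)).circleIntegrable η.2
  have hS := (hasFPowerSeriesOn_cauchy_integral hci hη0).analyticAt.differentiableAt
  -- The Cauchy integral of the `C(K, F)`-valued function is analytic. It equals `ψ` because
  -- evaluation at each `x` commutes with the integral and the scalar Cauchy formula holds for `ψ ·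
  -- x`.
  refine hS.congr_of_eventuallyEq ?_
  filter_upwards [ball_mem_nhds c (show (0 : ℝ) < η from hη0)] with w hw
  ext x
  have hne : ∀ z ∈ sphere c (η : ℝ), z - w ≠ 0 := by
    intro z hz h
    rw [sub_eq_zero.1 h, mem_sphere] at hz
    rw [mem_ball] at hw
    exact hw.ne hz
  have hcont : ContinuousOn (fun z => (z - w)⁻¹ • ψ z) (sphere c (η : ℝ)) := by
    refine ContinuousOn.smul (ContinuousOn.inv₀ (by fun_prop) hne) ?_
    exact hc.mono (sphere_subset_closedBall.trans hsub)
  have h1 : (∮ z in C(c, η), (z - w)⁻¹ • ψ z) x = ∮ z in C(c, η), (z - w)⁻¹ • ψ z x := by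
    have hi : CircleIntegrable (fun z => (z - w)⁻¹ • ψ z) c η := hcont.circleIntegrable η.2
    have := ContinuousLinearMap.intervalIntegral_comp_comm (ContinuousMap.evalCLM ℂ (M := F) x)
      hi.out
    simp only [circleIntegral]
    rw [← ContinuousMap.evalCLM_apply ℂ, ← this]
    rfl
  have h2 : DiffContOnCl ℂ (fun t => ψ t x) (ball c η) := by
    refine DifferentiableOn.diffContOnCl ?_
    rw [closure_ball c (NNReal.coe_ne_zero.2 hη0.ne')]
    exact (hd x).mono hsub
  have h3 := h2.two_pi_i_inv_smul_circleIntegral_sub_inv_smul hw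
  rw [ContinuousMap.smul_apply, h1, h3]

/-- Integration of continuous functions over a circle, as a continuous linear map. -/
theorem exists_circleIntegral_clm (F : Type) [NormedAddCommGroup F] [NormedSpace ℂ F]
    [CompleteSpace F] (c : ℂ) {ρ : ℝ} (hρ : 0 < ρ) :
    ∃ L : C(sphere c ρ, F) →L[ℂ] F, ∀ (g : C(sphere c ρ, F)) (h : ℂ → F),
      (∀ z : sphere c ρ, g z = h z) → L g = (2 * Real.pi * Complex.I : ℂ)⁻¹ • ∮ z in C(c, ρ), h z := by
  have hm : ∀ θ : ℝ, circleMap c ρ θ ∈ sphere c ρ := circleMap_mem_sphere c hρ.le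
  have hcm : Continuous fun θ : ℝ => (⟨circleMap c ρ θ, hm θ⟩ : sphere c ρ) := by
    exact (continuous_circleMap c ρ).subtype_mk _
  have hint : ∀ g : C(sphere c ρ, F), IntervalIntegrable
      (fun θ => deriv (circleMap c ρ) θ • g ⟨circleMap c ρ θ, hm θ⟩) MeasureTheory.volume
        0 (2 * Real.pi) := by
    intro g
    refine Continuous.intervalIntegrable ?_ _ _
    simp only [deriv_circleMap]
    exact ((continuous_circleMap 0 ρ).mul continuous_const).smul (g.continuous.comp hcm)
  let L₀ : C(sphere c ρ, F) →ₗ[ℂ] F :=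
    { toFun := fun g => (2 * Real.pi * Complex.I : ℂ)⁻¹ • ∫ θ in (0 : ℝ)..2 * Real.pi,
        deriv (circleMap c ρ) θ • g ⟨circleMap c ρ θ, hm θ⟩
      map_add' := fun g g' => by
        rw [← smul_add, ← intervalIntegral.integral_add (hint g) (hint g')]
        simp
      map_smul' := fun a g => by
        rw [RingHom.id_apply, smul_comm a]
        congr 1
        rw [← intervalIntegral.integral_smul]
        congr 1
        funext θ
        rw [ContinuousMap.smul_apply, smul_comm] }
  have hL₀ : ∀ g, L₀ g = (2 * Real.pi * Complex.I : ℂ)⁻¹ • ∫ θ in (0 : ℝ)..2 * Real.pi,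
      deriv (circleMap c ρ) θ • g ⟨circleMap c ρ θ, hm θ⟩ := fun g => rfl
  refine ⟨L₀.mkContinuous (‖(2 * Real.pi * Complex.I : ℂ)⁻¹‖ * (ρ * |2 * Real.pi - 0|)) ?_, ?_⟩
  · intro g
    have key : ‖∫ θ in (0 : ℝ)..2 * Real.pi,
        deriv (circleMap c ρ) θ • g ⟨circleMap c ρ θ, hm θ⟩‖ ≤ ρ * ‖g‖ * |2 * Real.pi - 0| := by
      refine intervalIntegral.norm_integral_le_of_norm_le_const fun θ _ => ?_
      rw [norm_smul]
      refine mul_le_mul ?_ (g.norm_coe_le_norm _) (norm_nonneg _) hρ.le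
      simp [abs_of_pos hρ]
    calc ‖L₀ g‖ = ‖(2 * Real.pi * Complex.I : ℂ)⁻¹‖ * ‖∫ θ in (0 : ℝ)..2 * Real.pi,
        deriv (circleMap c ρ) θ • g ⟨circleMap c ρ θ, hm θ⟩‖ := by rw [hL₀, norm_smul]
      _ ≤ ‖(2 * Real.pi * Complex.I : ℂ)⁻¹‖ * (ρ * ‖g‖ * |2 * Real.pi - 0|) :=
        mul_le_mul_of_nonneg_left key (norm_nonneg _)
      _ = _ := by ring
  · intro g h hgh
    simp only [LinearMap.mkContinuous_apply, circleIntegral, hL₀, hgh]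

/-- Osgood's lemma, by the Cauchy formula in the first variable. The remaining variables give a map
into `C(sphere, F)`, analytic by induction; this is why the target ranges over all commutative
Banach algebras. The Cauchy integral is then a continuous linear map applied to a product of two
analytic maps. -/
theorem analyticAt_of_continuousOn_of_separately (r : ℕ) :
    ∀ (F : Type) [NormedCommRing F] [NormedAlgebra ℂ F] [CompleteSpace F]
      (f : (Fin r → ℂ) → F) (p : Fin r → ℂ) (R : ℝ), 0 < R → ContinuousOn f (ball p R) →
      (∀ z ∈ ball p R, ∀ i, DifferentiableAt ℂ (fun t => f (Function.update z i t)) (z i)) →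
      AnalyticAt ℂ f p := by
  induction r with
  | zero =>
    intro F _ _ _ f p R hR hc hd
    have : f = fun _ => f p := by
      funext z; rw [Subsingleton.elim z p]
    rw [this]; exact analyticAt_const
  | succ r ih =>
    intro F _ _ _ f p R hR hc hd
    set ρ : ℝ := R / 2 with hρ
    have hρ0 : 0 < ρ := by positivity
    have hρR : ρ < R := by rw [hρ]; linarith
    have hmem : ∀ (t : ℂ) (z : Fin r → ℂ), t ∈ ball (p 0) R → z ∈ ball (Fin.tail p) R →
        (Fin.cons t z : Fin (r + 1) → ℂ) ∈ ball p R := by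
      intro t z ht hz
      rw [mem_ball, dist_pi_lt_iff hR] at *
      intro i
      refine Fin.cases ?_ (fun j => ?_) i
      · exact ht
      · exact hz j
    have hsph : ∀ ζ ∈ sphere (p 0) ρ, ζ ∈ ball (p 0) R := by
      intro ζ hζ
      rw [mem_sphere] at hζ
      rw [mem_ball, hζ]; exact hρR
    have hcons : Continuous fun q : ℂ × (Fin r → ℂ) => (Fin.cons q.1 q.2 : Fin (r + 1) → ℂ) := by
      refine continuous_pi fun i => ?_
      refine Fin.cases ?_ (fun j => ?_) i
      · exact continuous_fst
      · exact (continuous_apply j).comp continuous_snd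
    let Φ : C(ball (Fin.tail p) R × sphere (p 0) ρ, F) :=
      ⟨fun q => f (Fin.cons (q.2 : ℂ) (q.1 : Fin r → ℂ)), by
        refine hc.comp_continuous (hcons.comp
          ((continuous_subtype_val.comp continuous_snd).prodMk
            (continuous_subtype_val.comp continuous_fst))) ?_
        intro q
        exact hmem _ _ (hsph _ q.2.2) q.1.2⟩
    classical
    let φ : (Fin r → ℂ) → C(sphere (p 0) ρ, F) :=
      fun z => if h : z ∈ ball (Fin.tail p) R then Φ.curry ⟨z, h⟩ else 0
    have hφ : ∀ z ∈ ball (Fin.tail p) R, ∀ ζ, φ z ζ = f (Fin.cons (ζ : ℂ) z) := by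
      intro z hz ζ
      simp only [φ, dif_pos hz]
      rfl
    have hφc : ContinuousOn φ (ball (Fin.tail p) R) := by
      rw [continuousOn_iff_continuous_domRestrict]
      convert Φ.curry.continuous using 1
      funext z
      simp only [Set.domRestrict_apply, φ, dif_pos z.2]
    have hφa : AnalyticAt ℂ φ (Fin.tail p) := by
      refine ih _ φ _ R hR hφc ?_
      intro z hz i
      have hcu : Continuous fun t : ℂ => Function.update z i t :=
        continuous_const.update i continuous_id
      obtain ⟨η, hη, hηb⟩ : ∃ η > 0, ∀ t ∈ ball (z i) η,
          Function.update z i t ∈ ball (Fin.tail p) R := by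
        have : (fun t : ℂ => Function.update z i t) ⁻¹' ball (Fin.tail p) R ∈ 𝓝 (z i) := by
          refine hcu.continuousAt.preimage_mem_nhds ?_
          rw [Function.update_eq_self]
          exact isOpen_ball.mem_nhds hz
        obtain ⟨η, hη, h⟩ := Metric.mem_nhds_iff.1 this
        exact ⟨η, hη, fun t ht => h ht⟩
      refine differentiableAt_of_forall_eval hη ?_ ?_
      · exact ContinuousOn.comp (g := φ) (f := fun t : ℂ => Function.update z i t) hφc
          hcu.continuousOn hηb
      · intro ζ t ht
        have h1 : DifferentiableAt ℂ
            (fun u => f (Function.update (Fin.cons (ζ : ℂ) (Function.update z i t)) i.succ u)) t := by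
          have := hd _ (hmem ζ _ (hsph _ ζ.2) (hηb t ht)) i.succ
          simpa using this
        refine (h1.congr_of_eventuallyEq ?_).differentiableWithinAt
        filter_upwards [isOpen_ball.mem_nhds ht] with u hu
        rw [hφ _ (hηb u hu), ← Fin.cons_update, Function.update_idem]
    -- The kernel `(w - ζ)⁻¹`, as a function of `ζ` on the circle, is the resolvent at `w` of the
    -- coordinate function, so its analyticity in `w` comes from the differentiability of
    -- resolvents.
    let ι : C(sphere (p 0) ρ, F) :=
      ⟨fun ζ => algebraMap ℂ F ζ, (continuous_algebraMap ℂ F).comp continuous_subtype_val⟩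
    have hinv : ∀ w ∈ ball (p 0) ρ, ∀ ζ : sphere (p 0) ρ, w - ζ ≠ 0 := by
      intro w hw ζ h
      have := ζ.2
      rw [← sub_eq_zero.1 h, mem_sphere] at this
      rw [mem_ball] at hw
      exact hw.ne this
    have hres : ∀ w ∈ ball (p 0) ρ, w ∈ resolventSet ℂ ι ∧
        ∀ ζ : sphere (p 0) ρ, resolvent ι w ζ = algebraMap ℂ F (w - ζ)⁻¹ := by
      intro w hw
      let κ : C(sphere (p 0) ρ, F) := ⟨fun ζ => algebraMap ℂ F (w - ζ)⁻¹,
        (continuous_algebraMap ℂ F).comp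
          (Continuous.inv₀ (continuous_const.sub continuous_subtype_val) (hinv w hw))⟩
      have h1 : (algebraMap ℂ C(sphere (p 0) ρ, F) w - ι) * κ = 1 := by
        ext ζ
        change (algebraMap ℂ F w - algebraMap ℂ F ζ) * algebraMap ℂ F (w - ζ)⁻¹ = 1
        rw [← map_sub, ← map_mul, mul_inv_cancel₀ (hinv w hw ζ), map_one]
      have hu : IsUnit (algebraMap ℂ C(sphere (p 0) ρ, F) w - ι) :=
        IsUnit.of_mul_eq_one _ h1
      refine ⟨hu, fun ζ => ?_⟩
      have h2 : resolvent ι w = κ := by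
        refine hu.mul_left_cancel ?_
        rw [h1, resolvent, Ring.mul_inverse_cancel _ hu]
      rw [h2]; rfl
    have hκ : AnalyticAt ℂ (resolvent ι) (p 0) := by
      refine DifferentiableOn.analyticAt (s := ball (p 0) ρ) (fun w hw => ?_)
        (ball_mem_nhds _ hρ0)
      exact (spectrum.hasDerivAt_resolvent_const_left (hres w hw).1).differentiableAt.differentiableWithinAt
    obtain ⟨L, hL⟩ := exists_circleIntegral_clm F (p 0) hρ0
    have hev : f =ᶠ[𝓝 p] fun q => -L (resolvent ι (q 0) * φ (Fin.tail q)) := by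
      filter_upwards [ball_mem_nhds p hρ0] with q hq
      rw [mem_ball, dist_pi_lt_iff hρ0] at hq
      have hq0 : q 0 ∈ ball (p 0) ρ := hq 0
      have hqt : Fin.tail q ∈ ball (Fin.tail p) R := by
        rw [mem_ball, dist_pi_lt_iff hR]
        intro i
        exact (hq i.succ).trans hρR
      have hdc : DiffContOnCl ℂ (fun t => f (Fin.cons t (Fin.tail q))) (ball (p 0) ρ) := by
        refine DifferentiableOn.diffContOnCl ?_
        rw [closure_ball _ hρ0.ne']
        intro t ht
        have ht' : t ∈ ball (p 0) R := by
          rw [mem_closedBall] at ht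
          rw [mem_ball]; linarith
        have := hd _ (hmem t _ ht' hqt) 0
        simp only [Fin.update_cons_zero, Fin.cons_zero] at this
        exact this.differentiableWithinAt
      have h3 := hdc.two_pi_i_inv_smul_circleIntegral_sub_inv_smul hq0
      rw [Fin.cons_self_tail] at h3
      -- The sign appears because the resolvent is `(w - ζ)⁻¹` while the Cauchy kernel is `(ζ -
      -- w)⁻¹`.
      rw [← h3, hL _ (fun z => -((z - q 0)⁻¹ • f (Fin.cons z (Fin.tail q))))]
      · simp only [circleIntegral, smul_neg, intervalIntegral.integral_neg, neg_neg]
      · intro z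
        rw [ContinuousMap.mul_apply, (hres _ hq0).2 z, hφ _ hqt, ← Algebra.smul_def, ← neg_smul,
          ← inv_neg, neg_sub]
    refine AnalyticAt.congr ?_ hev.symm
    have ha0 : AnalyticAt ℂ (fun q : Fin (r + 1) → ℂ => q 0) p :=
      (ContinuousLinearMap.proj (R := ℂ) (φ := fun _ : Fin (r + 1) => ℂ) 0).analyticAt p
    have hat : AnalyticAt ℂ (fun q : Fin (r + 1) → ℂ => Fin.tail q) p := by
      refine AnalyticAt.pi fun i => ?_
      exact (ContinuousLinearMap.proj (R := ℂ) (φ := fun _ : Fin (r + 1) => ℂ) i.succ).analyticAt p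
    have hk2 : AnalyticAt ℂ (fun q : Fin (r + 1) → ℂ => resolvent ι (q 0)) p :=
      AnalyticAt.fun_comp hκ ha0
    have hf2 : AnalyticAt ℂ (fun q : Fin (r + 1) → ℂ => φ (Fin.tail q)) p :=
      AnalyticAt.fun_comp hφa hat
    exact (AnalyticAt.fun_comp (L.analyticAt _) (hk2.mul hf2)).neg

/-- The Weierstrass `M`-test for holomorphic functions of several variables. -/
theorem analyticAt_tsum {α : Type*} {r : ℕ} {f : α → (Fin r → ℂ) → ℂ} {u : α → ℝ}
    (hu : Summable u) {p : Fin r → ℂ} {R : ℝ} (hR : 0 < R)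
    (hf : ∀ a, AnalyticOnNhd ℂ (f a) (ball p R)) (hb : ∀ a, ∀ z ∈ ball p R, ‖f a z‖ ≤ u a) :
    AnalyticAt ℂ (fun z => ∑' a, f a z) p := by
  refine analyticAt_of_continuousOn_of_separately r ℂ _ p R hR ?_ ?_
  · exact continuousOn_tsum (fun a => (hf a).continuousOn) hu hb
  · intro z hz i
    have hcu : Continuous fun t : ℂ => Function.update z i t :=
      continuous_const.update i continuous_id
    have ho : IsOpen ((fun t : ℂ => Function.update z i t) ⁻¹' ball p R) :=
      isOpen_ball.preimage hcu
    have hz' : z i ∈ (fun t : ℂ => Function.update z i t) ⁻¹' ball p R := by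
      simpa using hz
    refine (Complex.differentiableOn_tsum_of_summable_norm hu (fun a => ?_) ho
      (fun a t ht => hb a _ ht)).differentiableAt (ho.mem_nhds hz')
    intro t ht
    refine (DifferentiableAt.comp t (hf a _ ht).differentiableAt ?_).differentiableWithinAt
    exact (hasDerivAt_update z i t).differentiableAt

/-! ### Absolute convergence -/

/-- Abel summation: `∑ a i * (x i - x₀)` is a combination of the tail sums of `a` with the
nonnegative increments of `x` as coefficients. -/
theorem sum_mul_nonneg_of_tail_nonneg (r : ℕ) :
    ∀ (a x : Fin r → ℝ) (x₀ : ℝ), Monotone x → (∀ i, x₀ ≤ x i) →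
      (∀ j, 0 ≤ ∑ i ∈ Finset.Ici j, a i) → (∑ i, a i) * x₀ ≤ ∑ i, a i * x i := by
  induction r with
  | zero => intro a x x₀ _ _ _; simp
  | succ r ih =>
    intro a x x₀ hx h0 ha
    have htail : ∀ j : Fin r, ∑ i ∈ Finset.Ici j, a i.succ = ∑ i ∈ Finset.Ici j.succ, a i := by
      intro j
      rw [← Fin.map_succEmb_Ici, Finset.sum_map]
      rfl
    have h1 := ih (fun i => a i.succ) (fun i => x i.succ) (x 0)
      (fun i j hij => hx (Fin.succ_le_succ_iff.2 hij)) (fun i => hx (Fin.zero_le _))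
      (fun j => by rw [htail]; exact ha _)
    have h2 : 0 ≤ ∑ i, a i := by
      have := ha 0
      rwa [show Finset.Ici (0 : Fin (r + 1)) = Finset.univ from by ext; simp] at this
    have h3 := h0 0
    rw [Fin.sum_univ_succ] at h2 ⊢
    rw [Fin.sum_univ_succ (f := fun i => a i * x i)]
    nlinarith

/-- On monotone tuples, a Dirichlet monomial whose exponents have large tail sums is dominated by
one whose exponents are all larger than `1`. -/
theorem prod_rpow_neg_le {r : ℕ} {σ : Fin r → ℝ} {η : ℝ}
    (hσ : ∀ j : Fin r, ((r - (j : ℕ) : ℕ) : ℝ) * (1 + η) ≤ ∑ i ∈ Finset.Ici j, σ i)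
    {m : Fin r → ℕ+} (hm : Monotone m) :
    ∏ i, ((m i : ℕ) : ℝ) ^ (-(σ i)) ≤ ∏ i, ((m i : ℕ) : ℝ) ^ (-(1 + η)) := by
  have hpos : ∀ i, (0 : ℝ) < ((m i : ℕ) : ℝ) := fun i => by exact_mod_cast (m i).pos
  -- After taking logarithms the claim is Abel summation for the excess exponents against the
  -- increasing, nonnegative numbers `log (m i)`.
  have h := sum_mul_nonneg_of_tail_nonneg r (fun i => σ i - (1 + η))
    (fun i => Real.log ((m i : ℕ) : ℝ)) 0
    (fun i j hij => Real.log_le_log (hpos i) (by exact_mod_cast hm hij))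
    (fun i => Real.log_nonneg (by exact_mod_cast (m i).pos))
    (fun j => by
      rw [Finset.sum_sub_distrib, Finset.sum_const, Fin.card_Ici, nsmul_eq_mul]
      linarith [hσ j])
  rw [mul_zero] at h
  simp only [Real.rpow_def_of_pos (hpos _), ← Real.exp_sum]
  refine Real.exp_le_exp.2 ?_
  rw [← sub_nonneg, ← Finset.sum_sub_distrib]
  refine h.trans_eq (Finset.sum_congr rfl fun i _ => by ring)

theorem summable_pnat_rpow_neg {p : ℝ} (hp : 1 < p) :
    Summable fun n : ℕ+ => ((n : ℕ) : ℝ) ^ (-p) :=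
  (Real.summable_nat_rpow.2 (by linarith)).comp_injective PNat.coe_injective

theorem summable_prod_rpow_neg (ι : Type*) [Fintype ι] {p : ℝ} (hp : 1 < p) :
    Summable fun m : ι → ℕ+ => ∏ i, ((m i : ℕ) : ℝ) ^ (-p) := by
  have key : ∀ r : ℕ, Summable fun m : Fin r → ℕ+ => ∏ i, ((m i : ℕ) : ℝ) ^ (-p) := by
    intro r
    induction r with
    | zero => exact Summable.of_finite
    | succ r ih =>
      have h := (summable_pnat_rpow_neg hp).mul_of_nonneg ih
        (fun n => by positivity) (fun m => by positivity)
      rw [← (Fin.consEquiv fun _ => ℕ+).summable_iff]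
      refine h.congr fun q => ?_
      simp [Fin.prod_univ_succ, Fin.consEquiv]
  have e := Fintype.equivFin ι
  rw [← (Equiv.arrowCongr e.symm (Equiv.refl ℕ+)).summable_iff]
  refine (key _).congr fun m => ?_
  exact (Fintype.prod_equiv e _ _ fun i => by simp [Equiv.arrowCongr]).symm

/-- The strict inequalities leave room for one `η` serving two purposes: it keeps the comparison
exponents above 1, and it absorbs the variation of the exponents over a ball of radius `η`. -/
theorem exists_pos_tail_le {r : ℕ} {σ : Fin r → ℝ}
    (hσ : ∀ j : Fin r, ((r - (j : ℕ) : ℕ) : ℝ) < ∑ i ∈ Finset.Ici j, σ i) :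
    ∃ η > 0, ∀ j : Fin r,
      ((r - (j : ℕ) : ℕ) : ℝ) * (1 + η) ≤ ∑ i ∈ Finset.Ici j, (σ i - η) := by
  have h : ∀ᶠ η in 𝓝[>] (0 : ℝ), ∀ j : Fin r,
      ((r - (j : ℕ) : ℕ) : ℝ) * (1 + η) < ∑ i ∈ Finset.Ici j, (σ i - η) := by
    rw [eventually_all]
    intro j
    refine nhdsWithin_le_nhds ?_
    refine ContinuousAt.eventually_lt (by fun_prop) (by fun_prop) ?_
    simpa using hσ j
  obtain ⟨η, hη, h0⟩ := (h.and self_mem_nhdsWithin).exists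
  exact ⟨η, h0, fun j => (hη j).le⟩

theorem norm_pnat_cpow (n : ℕ+) (a : ℂ) : ‖((n : ℕ) : ℂ) ^ a‖ = ((n : ℕ) : ℝ) ^ a.re :=
  Complex.norm_natCast_cpow_of_pos n.pos a

theorem pnat_rpow_le (n : ℕ+) {a b : ℝ} (h : a ≤ b) : ((n : ℕ) : ℝ) ^ a ≤ ((n : ℕ) : ℝ) ^ b :=
  Real.rpow_le_rpow_of_exponent_le (by exact_mod_cast n.pos) h

theorem norm_term {r : ℕ} (s : Fin r → ℂ) (m : Fin r → ℕ+) :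
    ‖term s m‖ = ∏ i, ((m i : ℕ) : ℝ) ^ (-(s i).re) := by
  simp [term, norm_prod, norm_pnat_cpow]

/-- Sums over monotone tuples of holomorphic functions dominated by Dirichlet monomials. -/
theorem summable_and_analyticAt_of_le {r : ℕ} {σ : Fin r → ℝ}
    (hσ : ∀ j : Fin r, ((r - (j : ℕ) : ℕ) : ℝ) < ∑ i ∈ Finset.Ici j, σ i)
    {f : (Fin r → ℕ+) → (Fin r → ℂ) → ℂ} {p : Fin r → ℂ}
    (hf : ∀ m z, AnalyticAt ℂ (f m) z) (h0 : ∀ m z, ¬ Monotone m → f m z = 0)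
    (hb : ∀ η > 0, ∃ C ≥ 0, ∀ m, ∀ z ∈ ball p η,
      ‖f m z‖ ≤ C * ∏ i, ((m i : ℕ) : ℝ) ^ (-(σ i - η))) :
    (Summable fun m => ‖f m p‖) ∧ AnalyticAt ℂ (fun z => ∑' m, f m z) p := by
  obtain ⟨η, hη, hle⟩ := exists_pos_tail_le hσ
  obtain ⟨C, hC, hb⟩ := hb η hη
  have hs : Summable fun m : Fin r → ℕ+ => C * ∏ i, ((m i : ℕ) : ℝ) ^ (-(1 + η)) :=
    (summable_prod_rpow_neg (Fin r) (by linarith)).mul_left C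
  have hb' : ∀ m, ∀ z ∈ ball p η, ‖f m z‖ ≤ C * ∏ i, ((m i : ℕ) : ℝ) ^ (-(1 + η)) := by
    intro m z hz
    by_cases hm : Monotone m
    · exact (hb m z hz).trans (mul_le_mul_of_nonneg_left (prod_rpow_neg_le hle hm) hC)
    · rw [h0 m z hm, norm_zero]
      positivity
  refine ⟨Summable.of_nonneg_of_le (fun _ => norm_nonneg _)
    (fun m => hb' m p (mem_ball_self hη)) hs, ?_⟩
  exact analyticAt_tsum hs hη (fun m z _ => hf m z) hb'

/-- Tuples with `m i + e ≤ m j` for `i < j`: strictly increasing ones for `e = 1`, and weakly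
increasing ones for `e = 0`. -/
def Chain (e : ℕ) {r : ℕ} (m : Fin r → ℕ+) : Prop :=
  ∀ i j, i < j → (m i : ℕ) + e ≤ m j

theorem Chain.monotone {e r : ℕ} {m : Fin r → ℕ+} (h : Chain e m) : Monotone m := by
  intro i j hij
  rcases hij.eq_or_lt with rfl | hij
  · exact le_rfl
  · exact_mod_cast (Nat.le_add_right _ _).trans (h i j hij)

theorem chain_one_iff {r : ℕ} {m : Fin r → ℕ+} : Chain 1 m ↔ StrictMono m :=
  Iff.rfl

theorem chain_zero_iff {r : ℕ} {m : Fin r → ℕ+} : Chain 0 m ↔ Monotone m := by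
  refine ⟨Chain.monotone, fun h i j hij => ?_⟩
  exact_mod_cast h hij.le

open Classical in
/-- The Euler-Zagier series over `Chain e`. -/
noncomputable def chainSeries (e r : ℕ) (s : Fin r → ℂ) : ℂ :=
  ∑' m : Fin r → ℕ+, if Chain e m then term s m else 0

theorem ezSeries_eq (r : ℕ) (s : Fin r → ℂ) : ezSeries r s = chainSeries 1 r s := by
  classical
  rw [ezSeries, chainSeries]
  refine (tsum_subtype {m : Fin r → ℕ+ | StrictMono m} (term s)).trans (tsum_congr fun m => ?_)
  by_cases h : StrictMono m <;> simp [Set.indicator, chain_one_iff, h]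

theorem ezStarSeries_eq (r : ℕ) (s : Fin r → ℂ) : ezStarSeries r s = chainSeries 0 r s := by
  classical
  rw [ezStarSeries, chainSeries]
  refine (tsum_subtype {m : Fin r → ℕ+ | Monotone m} (term s)).trans (tsum_congr fun m => ?_)
  by_cases h : Monotone m <;> simp [Set.indicator, chain_zero_iff, h]

theorem analyticAt_apply {r : ℕ} (i : Fin r) (z : Fin r → ℂ) :
    AnalyticAt ℂ (fun s : Fin r → ℂ => s i) z :=
  (ContinuousLinearMap.proj (R := ℂ) (φ := fun _ : Fin r => ℂ) i).analyticAt z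

theorem analyticAt_pnat_cpow {E : Type*} [NormedAddCommGroup E] [NormedSpace ℂ E] (n : ℕ+)
    {f : E → ℂ} {z : E} (hf : AnalyticAt ℂ f z) :
    AnalyticAt ℂ (fun s => ((n : ℕ) : ℂ) ^ f s) z := by
  have hn : ((n : ℕ) : ℂ) ≠ 0 := by exact_mod_cast n.ne_zero
  simp only [Complex.cpow_def_of_ne_zero hn]
  exact (analyticAt_const.mul hf).cexp

theorem analyticAt_term {r : ℕ} (m : Fin r → ℕ+) (z : Fin r → ℂ) :
    AnalyticAt ℂ (fun s => term s m) z := by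
  unfold term
  exact Finset.analyticAt_fun_prod _ fun i _ => analyticAt_pnat_cpow _ (analyticAt_apply i z).neg

theorem abs_re_sub_lt_of_mem_ball {r : ℕ} {p z : Fin r → ℂ} {η : ℝ} (hη : 0 < η)
    (hz : z ∈ ball p η) (i : Fin r) : |(z i).re - (p i).re| < η := by
  rw [mem_ball, dist_pi_lt_iff hη] at hz
  have := Complex.abs_re_le_norm (z i - p i)
  rw [Complex.sub_re] at this
  exact this.trans_lt (by rw [← dist_eq_norm]; exact hz i)

theorem norm_term_le_of_mem_ball {r : ℕ} {p z : Fin r → ℂ} {η : ℝ} (hη : 0 < η)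
    (hz : z ∈ ball p η) (m : Fin r → ℕ+) :
    ‖term z m‖ ≤ ∏ i, ((m i : ℕ) : ℝ) ^ (-((p i).re - η)) := by
  rw [norm_term]
  refine Finset.prod_le_prod (fun i _ => by positivity) fun i _ => pnat_rpow_le _ ?_
  have := abs_lt.1 (abs_re_sub_lt_of_mem_ball hη hz i)
  linarith

open Classical in
theorem summable_and_analyticAt_chain (e : ℕ) {r : ℕ} {p : Fin r → ℂ} (hp : p ∈ convDomain r) :
    (Summable fun m : Fin r → ℕ+ => ‖if Chain e m then term p m else 0‖) ∧
      AnalyticAt ℂ (chainSeries e r) p := by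
  refine summable_and_analyticAt_of_le (f := fun m s => if Chain e m then term s m else 0) hp ?_ ?_ ?_
  · intro m z
    by_cases h : Chain e m
    · simp only [if_pos h]; exact analyticAt_term m z
    · simp only [if_neg h]; exact analyticAt_const
  · intro m z hm
    exact if_neg fun h => hm h.monotone
  · intro η hη
    refine ⟨1, zero_le_one, fun m z hz => ?_⟩
    rw [one_mul]
    split_ifs
    · exact norm_term_le_of_mem_ball hη hz m
    · rw [norm_zero]; positivity

theorem summable_norm_term {r : ℕ} {s : Fin r → ℂ} (hs : s ∈ convDomain r) :
    Summable (fun m : {m : Fin r → ℕ+ // StrictMono m} => ‖term s m.1‖) ∧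
      Summable (fun m : {m : Fin r → ℕ+ // Monotone m} => ‖term s m.1‖) := by
  classical
  refine ⟨((summable_and_analyticAt_chain 1 hs).1.subtype {m | StrictMono m}).congr fun m => ?_,
    ((summable_and_analyticAt_chain 0 hs).1.subtype {m | Monotone m}).congr fun m => ?_⟩
  · simp only [Function.comp_apply]
    rw [if_pos (chain_one_iff.2 m.2)]
  · simp only [Function.comp_apply]
    rw [if_pos (chain_zero_iff.2 m.2)]

/-! ### Taylor expansion of `(1 + x) ^ a` with a remainder that is uniform in `a` -/

/-- The binomial coefficient `a (a - 1) ⋯ (a - k + 1) / k!`. -/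
noncomputable def binCoeff : ℕ → ℂ → ℂ
  | 0, _ => 1
  | k + 1, a => a / (k + 1) * binCoeff k (a - 1)

theorem analyticAt_binCoeff (k : ℕ) : ∀ a, AnalyticAt ℂ (binCoeff k) a := by
  induction k with
  | zero => intro a; exact analyticAt_const
  | succ k ih =>
    intro a
    have h1 : AnalyticAt ℂ (fun a : ℂ => binCoeff k (a - 1)) a :=
      AnalyticAt.fun_comp (g := binCoeff k) (f := fun a : ℂ => a - 1) (ih _)
        (analyticAt_id.sub analyticAt_const)
    exact (analyticAt_id.div_const).mul h1

/-- The derivative in `x` of the remainder of order `K + 1` for `a` is `a` times the remainder of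
order `K` for `a - 1`, so the mean value inequality gives an induction on `K`. The shift of `a` is
the reason for quantifying over `A` inside the induction. -/
theorem norm_one_add_cpow_sub_le (K : ℕ) : ∀ A : ℝ, ∃ C ≥ 0, ∀ a : ℂ, ‖a‖ ≤ A →
    ∀ x : ℝ, |x| ≤ 1 / 2 →
      ‖(1 + x : ℂ) ^ a - ∑ k ∈ Finset.range K, binCoeff k a * (x : ℂ) ^ k‖ ≤ C * |x| ^ K := by
  induction K with
  | zero =>
    intro A
    -- For `|x| ≤ 1 / 2` the base lies between `1 / 2` and `2`, hence `|log (1 + x)| ≤ log 2`.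
    refine ⟨2 ^ A, by positivity, fun a ha x hx => ?_⟩
    rw [abs_le] at hx
    have h1 : (0 : ℝ) < 1 + x := by linarith
    have h2 : ‖(1 + x : ℂ) ^ a‖ = (1 + x) ^ a.re := by
      rw [← Complex.norm_cpow_eq_rpow_re_of_pos h1]; push_cast; rfl
    simp only [Finset.range_zero, Finset.sum_empty, sub_zero, pow_zero, mul_one, h2]
    have h3 : |a.re| ≤ A := (Complex.abs_re_le_norm a).trans ha
    rw [Real.rpow_def_of_pos h1, Real.rpow_def_of_pos two_pos]
    refine Real.exp_le_exp.2 ?_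
    have h4 : |Real.log (1 + x)| ≤ Real.log 2 := by
      rw [abs_le, ← Real.log_inv]
      exact ⟨Real.log_le_log (by norm_num) (by linarith), Real.log_le_log h1 (by linarith)⟩
    calc Real.log (1 + x) * a.re ≤ |Real.log (1 + x) * a.re| := le_abs_self _
      _ = |Real.log (1 + x)| * |a.re| := abs_mul _ _
      _ ≤ Real.log 2 * A := mul_le_mul h4 h3 (abs_nonneg _) ((abs_nonneg _).trans h4)
  | succ K ih =>
    intro A
    obtain ⟨C, hC, h⟩ := ih (A + 1)
    refine ⟨|A| * C, by positivity, fun a ha x hx => ?_⟩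
    set g : ℝ → ℂ := fun y => (1 + y : ℂ) ^ a -
      ∑ k ∈ Finset.range (K + 1), binCoeff k a * (y : ℂ) ^ k with hg
    set g' : ℝ → ℂ := fun y => a * ((1 + y : ℂ) ^ (a - 1) -
      ∑ k ∈ Finset.range K, binCoeff k (a - 1) * (y : ℂ) ^ k) with hg'
    have hder : ∀ y : ℝ, |y| ≤ 1 / 2 → HasDerivAt g (g' y) y := by
      intro y hy
      rw [abs_le] at hy
      have hslit : (1 + y : ℂ) ∈ Complex.slitPlane := by
        left; simp; linarith
      have h1 : HasDerivAt (fun z : ℂ => (1 + z) ^ a) (a * (1 + y : ℂ) ^ (a - 1) * 1) (y : ℂ) :=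
        ((hasDerivAt_id (y : ℂ)).const_add 1).cpow_const hslit
      have h2 : HasDerivAt (fun z : ℂ => ∑ k ∈ Finset.range (K + 1), binCoeff k a * z ^ k)
          (∑ k ∈ Finset.range (K + 1), binCoeff k a * (k * (y : ℂ) ^ (k - 1))) (y : ℂ) :=
        HasDerivAt.fun_sum fun k _ => (hasDerivAt_pow k (y : ℂ)).const_mul _
      have h3 := (h1.sub h2).comp_ofReal
      refine h3.congr_deriv ?_
      simp only [hg', mul_one]
      rw [mul_sub, Finset.sum_range_succ', Finset.mul_sum]
      simp only [Nat.cast_zero, zero_mul, mul_zero, add_zero]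
      congr 1
      refine Finset.sum_congr rfl fun k _ => ?_
      have hk : (k : ℂ) + 1 ≠ 0 := Nat.cast_add_one_ne_zero k
      simp only [binCoeff, Nat.cast_add, Nat.cast_one, Nat.add_sub_cancel]
      field_simp
    have hg0 : g 0 = 0 := by
      simp [hg, Finset.sum_range_succ', binCoeff]
    have hbd : ∀ y : ℝ, |y| ≤ |x| → ‖g' y‖ ≤ |A| * (C * |x| ^ K) := by
      intro y hy
      have h1 := h (a - 1) (by
        calc ‖a - 1‖ ≤ ‖a‖ + ‖(1 : ℂ)‖ := norm_sub_le _ _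
          _ ≤ A + 1 := by rw [norm_one]; linarith) y (hy.trans hx)
      rw [hg', norm_mul]
      refine mul_le_mul (ha.trans (le_abs_self A)) (h1.trans ?_) (norm_nonneg _) (abs_nonneg _)
      gcongr
    have hmv := Convex.norm_image_sub_le_of_norm_hasDerivWithin_le (f := g) (f' := g')
      (s := Set.Icc (-|x|) |x|) (x := 0) (y := x) (C := |A| * (C * |x| ^ K))
      (fun y hy => (hder y ((abs_le.2 hy).trans hx)).hasDerivWithinAt)
      (fun y hy => hbd y (abs_le.2 hy)) (convex_Icc _ _) (by simp) (abs_le.1 le_rfl)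
    rw [hg0, sub_zero, sub_zero, Real.norm_eq_abs] at hmv
    refine hmv.trans_eq ?_
    ring

/-! ### Meromorphic continuation -/

/-- `N ^ b` for natural numbers `N`, with the value `0` at `N = 0` for every `b`. -/
noncomputable def natPow (N : ℕ) (b : ℂ) : ℂ := if N = 0 then 0 else (N : ℂ) ^ b

theorem natPow_pnat (n : ℕ+) (b : ℂ) : natPow n b = ((n : ℕ) : ℂ) ^ b := if_neg n.ne_zero

theorem analyticAt_natPow (N : ℕ) (b : ℂ) : AnalyticAt ℂ (natPow N) b := by
  unfold natPow
  rcases Nat.eq_zero_or_pos N with h | h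
  · simp only [if_pos h]; exact analyticAt_const
  · simp only [if_neg h.ne']
    exact analyticAt_pnat_cpow ⟨N, h⟩ analyticAt_id

/-- The differences whose sum over `n ≥ N + e` telescopes to `N ^ (1 - a)`. -/
noncomputable def powDiff (e : ℕ) (n : ℕ+) (a : ℂ) : ℂ :=
  natPow (n - e) (1 - a) - natPow (n - e + 1) (1 - a)

theorem analyticAt_powDiff (e : ℕ) (n : ℕ+) (a : ℂ) : AnalyticAt ℂ (powDiff e n) a := by
  have h : AnalyticAt ℂ (fun a : ℂ => 1 - a) a := analyticAt_const.sub analyticAt_id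
  exact (AnalyticAt.fun_comp (analyticAt_natPow _ _) h).sub
    (AnalyticAt.fun_comp (analyticAt_natPow _ _) h)

/-- The coefficients of the expansion of `powDiff`; `ε` is `1` for `e = 0` and `-1` for `e = 1`. -/
noncomputable def diffCoeff (ε : ℝ) (k : ℕ) (a : ℂ) : ℂ :=
  -ε * (binCoeff (k + 1) (1 - a) * (ε : ℂ) ^ (k + 1))

theorem analyticAt_diffCoeff (ε : ℝ) (k : ℕ) (a : ℂ) : AnalyticAt ℂ (diffCoeff ε k) a := by
  have h : AnalyticAt ℂ (fun a : ℂ => 1 - a) a := analyticAt_const.sub analyticAt_id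
  exact analyticAt_const.mul
    ((AnalyticAt.fun_comp (analyticAt_binCoeff (k + 1) _) h).mul analyticAt_const)

/-- Factoring out `n ^ (1 - a)` leaves a Taylor expansion at `x = ε / n`; the bound `2 ≤ n` puts `x`
within its range. The constant term cancels, which lowers the exponent by one, and the factor `-ε`
makes the leading coefficient `a - 1` for both signs. -/
theorem norm_pow_sub_expansion_le {ε : ℝ} (hε : |ε| = 1) (K : ℕ) (A : ℝ) :
    ∃ C ≥ 0, ∀ a : ℂ, ‖a‖ ≤ A → ∀ n : ℕ+, 2 ≤ (n : ℕ) →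
      ‖-ε * ((((n : ℕ) : ℝ) + ε : ℝ) ^ (1 - a) - ((n : ℕ) : ℂ) ^ (1 - a)) -
        ∑ k ∈ Finset.range K, diffCoeff ε k a * ((n : ℕ) : ℂ) ^ (-a - k)‖ ≤
      C * ((n : ℕ) : ℝ) ^ (-a.re - K) := by
  obtain ⟨C, hC, h⟩ := norm_one_add_cpow_sub_le (K + 1) (A + 1)
  refine ⟨C, hC, fun a ha n hn => ?_⟩
  have hn2 : (2 : ℝ) ≤ ((n : ℕ) : ℝ) := by exact_mod_cast hn
  have hn0 : (0 : ℝ) < ((n : ℕ) : ℝ) := by linarith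
  have hnC : ((n : ℕ) : ℂ) ≠ 0 := by exact_mod_cast n.ne_zero
  set x : ℝ := ε / ((n : ℕ) : ℝ) with hx
  have hxabs : |x| = (((n : ℕ) : ℝ))⁻¹ := by
    rw [hx, abs_div, hε, abs_of_pos hn0, one_div]
  have hx2 : |x| ≤ 1 / 2 := by
    rw [hxabs, one_div]; exact inv_anti₀ two_pos hn2
  have h1a : ‖1 - a‖ ≤ A + 1 := by
    calc ‖1 - a‖ ≤ ‖(1 : ℂ)‖ + ‖a‖ := norm_sub_le _ _
      _ ≤ A + 1 := by rw [norm_one]; linarith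
  have hb := h (1 - a) h1a x hx2
  have h1 : (((((n : ℕ) : ℝ) + ε : ℝ) : ℂ)) ^ (1 - a) =
      ((n : ℕ) : ℂ) ^ (1 - a) * (1 + x : ℂ) ^ (1 - a) := by
    have hx1 : 0 ≤ 1 + x := by linarith [(abs_le.1 hx2).1]
    have := Complex.mul_cpow_ofReal_nonneg hn0.le hx1 (1 - a)
    rw [← Complex.ofReal_mul] at this
    rw [show ((n : ℕ) : ℝ) + ε = ((n : ℕ) : ℝ) * (1 + x) by rw [hx]; field_simp, this]
    push_cast; rfl
  have h2 : ∀ k : ℕ, diffCoeff ε k a * ((n : ℕ) : ℂ) ^ (-a - k) =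
      -ε * ((n : ℕ) : ℂ) ^ (1 - a) * (binCoeff (k + 1) (1 - a) * (x : ℂ) ^ (k + 1)) := by
    intro k
    have h3 : ((n : ℕ) : ℂ) ^ (-a - k) = ((n : ℕ) : ℂ) ^ (1 - a) / ((n : ℕ) : ℂ) ^ (k + 1) := by
      rw [show (-a - k : ℂ) = (1 - a) - ((k + 1 : ℕ) : ℂ) by push_cast; ring,
        Complex.cpow_sub _ _ hnC, Complex.cpow_natCast]
    rw [h3, diffCoeff, hx, Complex.ofReal_div, div_pow]
    push_cast
    ring
  have h4 : -(ε : ℂ) * ((((n : ℕ) : ℝ) + ε : ℝ) ^ (1 - a) - ((n : ℕ) : ℂ) ^ (1 - a)) -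
        ∑ k ∈ Finset.range K, diffCoeff ε k a * ((n : ℕ) : ℂ) ^ (-a - k) =
      -ε * ((n : ℕ) : ℂ) ^ (1 - a) * ((1 + x : ℂ) ^ (1 - a) -
        ∑ k ∈ Finset.range (K + 1), binCoeff k (1 - a) * (x : ℂ) ^ k) := by
    rw [h1, Finset.sum_range_succ', Finset.sum_congr rfl fun k _ => h2 k, ← Finset.mul_sum]
    simp only [binCoeff, pow_zero]
    ring
  rw [h4, norm_mul, norm_mul, norm_neg, Complex.norm_real, Real.norm_eq_abs, hε, one_mul,
    norm_pnat_cpow]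
  calc ((n : ℕ) : ℝ) ^ (1 - a).re * _ ≤ ((n : ℕ) : ℝ) ^ (1 - a).re * (C * |x| ^ (K + 1)) := by
        gcongr
    _ = C * (((n : ℕ) : ℝ) ^ (1 - a).re * ((n : ℕ) : ℝ) ^ (-((K + 1 : ℕ) : ℝ))) := by
        rw [hxabs, Real.rpow_neg hn0.le, Real.rpow_natCast, inv_pow]; ring
    _ = C * ((n : ℕ) : ℝ) ^ (-a.re - K) := by
        rw [← Real.rpow_add hn0]
        congr 2
        simp
        ring

theorem exists_powDiff_expansion {e : ℕ} (he : e ≤ 1) :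
    ∃ d : ℕ → ℂ → ℂ, (∀ k a, AnalyticAt ℂ (d k) a) ∧ (∀ a, d 0 a = a - 1) ∧
      ∀ (K : ℕ) (A : ℝ), ∃ C ≥ 0, ∀ a : ℂ, ‖a‖ ≤ A → ∀ n : ℕ+,
        ‖powDiff e n a - ∑ k ∈ Finset.range K, d k a * ((n : ℕ) : ℂ) ^ (-a - k)‖ ≤
          C * ((n : ℕ) : ℝ) ^ (-a.re - K) := by
  obtain ⟨ε, hε, hεe⟩ : ∃ ε : ℝ, |ε| = 1 ∧ ∀ (n : ℕ+) (a : ℂ), 2 ≤ (n : ℕ) →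
      powDiff e n a = -ε * ((((n : ℕ) : ℝ) + ε : ℝ) ^ (1 - a) - ((n : ℕ) : ℂ) ^ (1 - a)) := by
    interval_cases e
    · refine ⟨1, by simp, fun n a hn => ?_⟩
      have h := natPow_pnat (n + 1) (1 - a)
      rw [PNat.add_coe, PNat.one_coe] at h
      rw [powDiff, Nat.sub_zero, h, natPow_pnat]
      push_cast
      ring
    · refine ⟨-1, by simp, fun n a hn => ?_⟩
      have h : natPow ((n : ℕ) - 1) (1 - a) = (((n : ℕ) - 1 : ℕ) : ℂ) ^ (1 - a) :=
        if_neg (by omega)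
      rw [powDiff, Nat.sub_add_cancel (by omega), h, natPow_pnat, Nat.cast_sub (by omega)]
      push_cast
      ring_nf
  refine ⟨diffCoeff ε, analyticAt_diffCoeff ε, fun a => ?_, fun K A => ?_⟩
  · have h2 : (ε : ℂ) ^ 2 = 1 := by
      rw [← Complex.ofReal_pow, ← sq_abs, hε]; simp
    simp only [diffCoeff, binCoeff]
    push_cast
    linear_combination (a - 1) * h2
  · obtain ⟨C, hC, h⟩ := norm_pow_sub_expansion_le hε K A
    -- The case `n = 1` is outside the Taylor estimate; a bound on the compact disc suffices there,
    -- as every power of 1 is 1.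
    have hcont : Continuous fun a : ℂ => powDiff e 1 a -
        ∑ k ∈ Finset.range K, diffCoeff ε k a * (((1 : ℕ+) : ℕ) : ℂ) ^ (-a - k) := by
      refine continuous_iff_continuousAt.2 fun a => AnalyticAt.continuousAt (𝕜 := ℂ) ?_
      refine (analyticAt_powDiff e 1 a).sub (Finset.analyticAt_fun_sum _ fun k _ => ?_)
      exact (analyticAt_diffCoeff ε k a).mul
        (analyticAt_pnat_cpow 1 (analyticAt_id.neg.sub analyticAt_const))
    obtain ⟨C', hC'⟩ := (isCompact_closedBall (0 : ℂ) A).exists_bound_of_continuousOn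
      hcont.continuousOn
    refine ⟨max C C', le_max_of_le_left hC, fun a ha n => ?_⟩
    rcases Nat.lt_or_ge (n : ℕ) 2 with hn | hn
    · have hn1 : n = 1 := by
        have := n.pos
        exact PNat.coe_injective (by rw [PNat.one_coe]; omega)
      subst hn1
      have := hC' a (mem_closedBall_zero_iff.2 ha)
      refine this.trans ?_
      simp
    · rw [hεe n a hn]
      refine (h a ha n hn).trans ?_
      gcongr
      exact le_max_left _ _

/-- With `n = N + e + j` the terms telescope and tend to zero since `1 < a.re`. The case `N = 0` is
allowed for `e = 1`; there the convention `natPow 0 b = 0` makes the sum vanish. -/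
theorem tsum_powDiff {e N : ℕ} (hN : 1 ≤ N + e) {a : ℂ} (ha : 1 < a.re)
    (hs : Summable fun n : ℕ+ => if N + e ≤ n then powDiff e n a else 0) :
    ∑' n : ℕ+, (if N + e ≤ n then powDiff e n a else 0) = natPow N (1 - a) := by
  set g : ℕ → ℕ+ := fun j => ⟨N + e + j, by omega⟩ with hg
  have hinj : Function.Injective g := by
    intro i j hij
    have := congrArg PNat.val hij
    simp only [hg, PNat.mk_coe] at this
    omega
  have hsupp : Function.support (fun n : ℕ+ => if N + e ≤ n then powDiff e n a else 0) ⊆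
      Set.range g := by
    intro n hn
    have h : N + e ≤ n := by
      by_contra h
      exact hn (if_neg h)
    refine ⟨n - (N + e), PNat.coe_injective ?_⟩
    simp only [hg, PNat.mk_coe]
    omega
  have hval : ∀ j, (if N + e ≤ g j then powDiff e (g j) a else 0) =
      natPow (N + j) (1 - a) - natPow (N + (j + 1)) (1 - a) := by
    intro j
    have h1 : (g j : ℕ) = N + e + j := rfl
    rw [if_pos (by omega), powDiff, h1, show N + e + j - e = N + j by omega, Nat.add_assoc]
  rw [← hinj.tsum_eq hsupp]
  have hs' := (hs.comp_injective hinj).hasSum.tendsto_sum_nat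
  simp only [Function.comp_def] at hs'
  refine tendsto_nhds_unique hs' ?_
  simp only [hval, Finset.sum_range_sub' (fun j => natPow (N + j) (1 - a)), Nat.add_zero]
  have hlim : Tendsto (fun n => natPow (N + n) (1 - a)) atTop (𝓝 0) := by
    rw [tendsto_zero_iff_norm_tendsto_zero]
    have h1 : Tendsto (fun n : ℕ => ((n : ℕ) : ℝ) ^ (-(a.re - 1))) atTop (𝓝 0) :=
      (tendsto_rpow_neg_atTop (by linarith)).comp tendsto_natCast_atTop_atTop
    have h2 : Tendsto (fun n => N + n) atTop atTop := tendsto_atTop_mono (fun n => Nat.le_add_left n N) tendsto_id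
    refine (h1.comp h2).congr' ?_
    filter_upwards [eventually_gt_atTop 0] with n hn
    rw [natPow, if_neg (by omega)]
    simp only [Function.comp_apply]
    rw [Complex.norm_natCast_cpow_of_pos (by omega)]
    congr 1
    simp
  simpa using tendsto_const_nhds.sub hlim

/-! ### The Gamma factor -/

/-- `s_j + ⋯ + s_r`. -/
noncomputable def tail {r : ℕ} (s : Fin r → ℂ) (j : Fin r) : ℂ := ∑ i ∈ Finset.Ici j, s i

/-- The product of reciprocal Gamma values that cancels the poles of the Euler-Zagier
zeta-functions. -/
noncomputable def gammaFactor (r : ℕ) (s : Fin r → ℂ) : ℂ :=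
  ∏ j : Fin r, (Complex.Gamma (tail s j - ((r - (j : ℕ) : ℕ) : ℂ)))⁻¹

theorem analyticAt_tail {r : ℕ} (j : Fin r) (z : Fin r → ℂ) :
    AnalyticAt ℂ (fun s => tail s j) z :=
  Finset.analyticAt_fun_sum _ fun i _ => analyticAt_apply i z

theorem analyticAt_one_div_Gamma {E : Type*} [NormedAddCommGroup E] [NormedSpace ℂ E]
    {f : E → ℂ} {z : E} (hf : AnalyticAt ℂ f z) :
    AnalyticAt ℂ (fun s => (Complex.Gamma (f s))⁻¹) z :=
  AnalyticAt.fun_comp (g := fun w : ℂ => (Complex.Gamma w)⁻¹)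
    (Complex.differentiable_one_div_Gamma.analyticAt _) hf

theorem analyticAt_gammaFactor (r : ℕ) (z : Fin r → ℂ) : AnalyticAt ℂ (gammaFactor r) z :=
  Finset.analyticAt_fun_prod _ fun j _ =>
    analyticAt_one_div_Gamma ((analyticAt_tail j z).sub analyticAt_const)

theorem gammaFactor_ne_zero {r : ℕ} {s : Fin r → ℂ} (hs : s ∈ convDomain r) :
    gammaFactor r s ≠ 0 := by
  refine Finset.prod_ne_zero_iff.2 fun j _ => inv_ne_zero ?_
  refine Complex.Gamma_ne_zero_of_re_pos ?_
  have := hs j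
  simp only [tail, Complex.sub_re, Complex.re_sum, Complex.natCast_re]
  linarith

/-! ### The exhausting regions -/

/-- The region on which the `n`-th step of the continuation takes place. -/
def shiftedDomain (r n : ℕ) : Set (Fin r → ℂ) :=
  {s | ∀ j : Fin r, ((r - (j : ℕ) : ℕ) : ℝ) - n < ∑ i ∈ Finset.Ici j, (s i).re}

theorem convDomain_eq (r : ℕ) : convDomain r = shiftedDomain r 0 := by
  simp [convDomain, shiftedDomain]

theorem shiftedDomain_mono (r : ℕ) {n n' : ℕ} (h : n ≤ n') :
    shiftedDomain r n ⊆ shiftedDomain r n' := by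
  intro s hs j
  have := hs j
  have h' : (n : ℝ) ≤ n' := by exact_mod_cast h
  linarith

theorem convDomain_subset (r n : ℕ) : convDomain r ⊆ shiftedDomain r n := by
  rw [convDomain_eq]; exact shiftedDomain_mono r (Nat.zero_le n)

theorem isOpen_shiftedDomain (r n : ℕ) : IsOpen (shiftedDomain r n) := by
  simp only [shiftedDomain, ofPred_forall]
  refine isOpen_iInter_of_finite fun j => isOpen_lt continuous_const ?_
  exact continuous_finsetSum _ fun i _ => Complex.continuous_re.comp (continuous_apply i)

theorem isOpen_convDomain (r : ℕ) : IsOpen (convDomain r) := by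
  rw [convDomain_eq]; exact isOpen_shiftedDomain r 0

theorem isPreconnected_shiftedDomain (r n : ℕ) : IsPreconnected (shiftedDomain r n) := by
  refine Convex.isPreconnected ?_
  intro x hx y hy a b ha hb hab j
  have h1 := hx j
  have h2 := hy j
  have h3 : ∑ i ∈ Finset.Ici j, ((a • x + b • y) i).re =
      a * ∑ i ∈ Finset.Ici j, (x i).re + b * ∑ i ∈ Finset.Ici j, (y i).re := by
    simp [Finset.sum_add_distrib, Finset.mul_sum]
  rw [h3]
  set u : ℝ := ((r - (j : ℕ) : ℕ) : ℝ) - n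
  have h4 : u = a * u + b * u := by rw [← add_mul, hab, one_mul]
  rw [h4]
  rcases ha.eq_or_lt with rfl | ha
  · have : b = 1 := by linarith
    subst this; linarith
  · have := mul_lt_mul_of_pos_left h1 ha
    have := mul_le_mul_of_nonneg_left h2.le hb
    linarith

theorem mem_convDomain_of_one_lt {r : ℕ} {s : Fin r → ℂ} (hs : ∀ i, 1 < (s i).re) :
    s ∈ convDomain r := by
  intro j
  have : ∑ i ∈ Finset.Ici j, (1 : ℝ) < ∑ i ∈ Finset.Ici j, (s i).re :=
    Finset.sum_lt_sum_of_nonempty ⟨j, Finset.mem_Ici.2 le_rfl⟩ fun i _ => hs i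
  simpa using this

theorem convDomain_nonempty (r : ℕ) : (convDomain r).Nonempty :=
  ⟨fun _ => 2, mem_convDomain_of_one_lt fun _ => by norm_num⟩

theorem exists_mem_shiftedDomain {r : ℕ} (s : Fin r → ℂ) : ∃ n, s ∈ shiftedDomain r n := by
  have h : ∀ᶠ n : ℕ in atTop, ∀ j : Fin r,
      ((r - (j : ℕ) : ℕ) : ℝ) - n < ∑ i ∈ Finset.Ici j, (s i).re := by
    rw [eventually_all]
    intro j
    filter_upwards [tendsto_natCast_atTop_atTop.eventually_gt_atTop
      (((r - (j : ℕ) : ℕ) : ℝ) - ∑ i ∈ Finset.Ici j, (s i).re)] with n hn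
    linarith
  exact h.exists

theorem eqOn_shiftedDomain {r n : ℕ} {f g : (Fin r → ℂ) → ℂ}
    (hf : AnalyticOnNhd ℂ f (shiftedDomain r n)) (hg : AnalyticOnNhd ℂ g (shiftedDomain r n))
    (h : EqOn f g (convDomain r)) : EqOn f g (shiftedDomain r n) := by
  obtain ⟨z, hz⟩ := convDomain_nonempty r
  refine hf.eqOn_of_preconnected_of_eventuallyEq hg (isPreconnected_shiftedDomain r n)
    (convDomain_subset r n hz) ?_
  filter_upwards [(isOpen_convDomain r).mem_nhds hz] with s hs using h hs

/-- Holomorphic functions on the exhausting regions that agree on the domain of convergence glue. -/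
theorem exists_entire_of_forall_shiftedDomain {r : ℕ} {f : (Fin r → ℂ) → ℂ}
    (h : ∀ n, ∃ G, AnalyticOnNhd ℂ G (shiftedDomain r n) ∧ EqOn G f (convDomain r)) :
    ∃ G, (∀ z, AnalyticAt ℂ G z) ∧ EqOn G f (convDomain r) := by
  choose G hG hGf using h
  choose N hN using fun s : Fin r → ℂ => exists_mem_shiftedDomain s
  have key : ∀ n, EqOn (fun s => G (N s) s) (G n) (shiftedDomain r n) := by
    intro n s hs
    rcases le_total (N s) n with hle | hle
    · exact eqOn_shiftedDomain (hG _) ((hG n).mono (shiftedDomain_mono r hle))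
        (fun z hz => (hGf _ hz).trans (hGf _ hz).symm) (hN s)
    · exact eqOn_shiftedDomain ((hG _).mono (shiftedDomain_mono r hle)) (hG n)
        (fun z hz => (hGf _ hz).trans (hGf _ hz).symm) hs
  refine ⟨fun s => G (N s) s, fun z => ?_, fun z hz => hGf _ hz⟩
  refine (hG (N z) z (hN z)).congr ?_
  filter_upwards [(isOpen_shiftedDomain r (N z)).mem_nhds (hN z)] with s hs
  exact (key _ hs).symm

/-! ### Behaviour under merging and shifting arguments -/

/-- The rising factorial `z (z + 1) ⋯ (z + k - 1)`. -/
noncomputable def rising (k : ℕ) (z : ℂ) : ℂ := ∏ i ∈ Finset.range k, (z + i)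

theorem one_div_Gamma_eq_rising_mul (k : ℕ) (z : ℂ) :
    (Complex.Gamma z)⁻¹ = rising k z * (Complex.Gamma (z + k))⁻¹ := by
  induction k with
  | zero => simp [rising]
  | succ k ih =>
    rw [ih, rising, rising, Finset.prod_range_succ,
      Complex.one_div_Gamma_eq_self_mul_one_div_Gamma_add_one (z + k)]
    push_cast
    ring_nf

theorem analyticAt_rising {E : Type*} [NormedAddCommGroup E] [NormedSpace ℂ E] (k : ℕ)
    {f : E → ℂ} {z : E} (hf : AnalyticAt ℂ f z) : AnalyticAt ℂ (fun s => rising k (f s)) z :=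
  Finset.analyticAt_fun_prod _ fun _ _ => hf.add analyticAt_const

/-- The arguments that remain after summation over the last variable. -/
noncomputable def merge {r : ℕ} (s : Fin (r + 1) → ℂ) : Fin r → ℂ :=
  fun i => s i.castSucc + if (i : ℕ) + 1 = r then s (Fin.last r) - 1 else 0

/-- Addition of `k` to the last argument. -/
noncomputable def shiftLast {r : ℕ} (s : Fin (r + 1) → ℂ) (k : ℂ) : Fin (r + 1) → ℂ :=
  fun i => s i + if i = Fin.last r then k else 0

theorem analyticAt_merge {r : ℕ} (z : Fin (r + 1) → ℂ) : AnalyticAt ℂ merge z := by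
  refine AnalyticAt.pi fun i => (analyticAt_apply _ z).add ?_
  by_cases h : (i : ℕ) + 1 = r
  · simp only [if_pos h]; exact (analyticAt_apply _ z).sub analyticAt_const
  · simp only [if_neg h]; exact analyticAt_const

theorem analyticAt_shiftLast {r : ℕ} (k : ℂ) (z : Fin (r + 1) → ℂ) :
    AnalyticAt ℂ (fun s => shiftLast s k) z :=
  AnalyticAt.pi fun i => (analyticAt_apply i z).add analyticAt_const

theorem sum_Ici_castSucc {M : Type*} [AddCommMonoid M] {r : ℕ} (f : Fin (r + 1) → M) (j : Fin r) :
    ∑ i ∈ Finset.Ici j.castSucc, f i = ∑ i ∈ Finset.Ici j, f i.castSucc + f (Fin.last r) := by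
  have h1 : ∀ (n : ℕ) (g : Fin n → M) (k : Fin n),
      ∑ i ∈ Finset.Ici k, g i = ∑ i, if k ≤ i then g i else 0 := by
    intro n g k
    rw [← Finset.sum_filter]
    congr 1
    ext; simp
  rw [h1, h1, Fin.sum_univ_castSucc]
  simp [Fin.le_last]

theorem sum_Ici_last {M : Type*} [AddCommMonoid M] {r : ℕ} (f : Fin (r + 1) → M) :
    ∑ i ∈ Finset.Ici (Fin.last r), f i = f (Fin.last r) := by
  rw [show Finset.Ici (Fin.last r) = {Fin.last r} by ext; simp]
  simp

theorem tail_last {r : ℕ} (s : Fin (r + 1) → ℂ) : tail s (Fin.last r) = s (Fin.last r) :=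
  sum_Ici_last s

theorem tail_merge {r : ℕ} (s : Fin (r + 1) → ℂ) (j : Fin r) :
    tail (merge s) j = tail s j.castSucc - 1 := by
  obtain ⟨r, rfl⟩ : ∃ r', r = r' + 1 := ⟨r - 1, by have := j.2; omega⟩
  rw [tail, tail, sum_Ici_castSucc]
  simp only [merge, Finset.sum_add_distrib]
  rw [add_sub_assoc]
  congr 1
  rw [Finset.sum_eq_single (Fin.last r)]
  · simp
  · intro i _ hi
    rw [if_neg]
    intro h
    exact hi (Fin.ext (by simpa using h))
  · intro h
    exact absurd (Finset.mem_Ici.2 (Fin.le_last j)) h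

theorem tail_shiftLast {r : ℕ} (s : Fin (r + 1) → ℂ) (k : ℂ) (j : Fin (r + 1)) :
    tail (shiftLast s k) j = tail s j + k := by
  simp only [tail, shiftLast, Finset.sum_add_distrib]
  congr 1
  rw [Finset.sum_ite_eq', if_pos (Finset.mem_Ici.2 (Fin.le_last j))]

theorem mem_shiftedDomain_iff {r n : ℕ} {s : Fin r → ℂ} :
    s ∈ shiftedDomain r n ↔ ∀ j : Fin r, ((r - (j : ℕ) : ℕ) : ℝ) - n < (tail s j).re := by
  simp [shiftedDomain, tail]

theorem merge_mem_convDomain {r : ℕ} {s : Fin (r + 1) → ℂ} (hs : s ∈ convDomain (r + 1)) :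
    merge s ∈ convDomain r := by
  rw [convDomain_eq, mem_shiftedDomain_iff] at *
  intro j
  have := hs j.castSucc
  rw [tail_merge, Complex.sub_re, Complex.one_re]
  rw [Fin.val_castSucc, Nat.sub_add_comm j.2.le] at this
  push_cast at this ⊢
  linarith

theorem shiftLast_mem {r n : ℕ} {s : Fin (r + 1) → ℂ} (k : ℕ) {n' : ℕ} (hn : n' ≤ n + k)
    (hs : s ∈ shiftedDomain (r + 1) n') : shiftLast s k ∈ shiftedDomain (r + 1) n := by
  rw [mem_shiftedDomain_iff] at *
  intro j
  have := hs j
  rw [tail_shiftLast, Complex.add_re, Complex.natCast_re]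
  have h' : (n' : ℝ) ≤ n + k := by exact_mod_cast hn
  linarith

theorem one_lt_re_last {r : ℕ} {s : Fin (r + 1) → ℂ} (hs : s ∈ convDomain (r + 1)) :
    1 < (s (Fin.last r)).re := by
  have := hs (Fin.last r)
  rw [sum_Ici_last] at this
  simpa using this

/-- Merging lowers every tail sum by 1, and removing one variable lowers every bound by 1, so all
factors but the last agree. -/
theorem gammaFactor_succ {r : ℕ} (s : Fin (r + 1) → ℂ) :
    gammaFactor (r + 1) s =
      gammaFactor r (merge s) * (Complex.Gamma (s (Fin.last r) - 1))⁻¹ := by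
  rw [gammaFactor, Fin.prod_univ_castSucc, gammaFactor, tail_last]
  congr 1
  · refine Finset.prod_congr rfl fun j _ => ?_
    rw [tail_merge, Fin.val_castSucc, Nat.sub_add_comm j.2.le]
    push_cast
    ring_nf
  · simp

/-- This isolates the factor `s_r - 1` by which the recursion for the series has to be multiplied.
-/
theorem gammaFactor_succ' {r : ℕ} (s : Fin (r + 1) → ℂ) :
    gammaFactor (r + 1) s = gammaFactor r (merge s) * (Complex.Gamma (s (Fin.last r)))⁻¹ *
      (s (Fin.last r) - 1) := by
  rw [gammaFactor_succ, Complex.one_div_Gamma_eq_self_mul_one_div_Gamma_add_one (_ - 1),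
    sub_add_cancel]
  ring

/-- By the functional equation of Gamma, shifting costs only a polynomial. The last factor needs
`rising k` rather than `rising (k + 1)`, since it starts at `s_r` and not at `s_r - 1`. -/
theorem exists_gammaFactor_shiftLast (r k : ℕ) : ∃ q : (Fin (r + 1) → ℂ) → ℂ,
    (∀ z, AnalyticAt ℂ q z) ∧ ∀ s : Fin (r + 1) → ℂ,
      gammaFactor r (merge s) * (Complex.Gamma (s (Fin.last r)))⁻¹ =
        q s * gammaFactor (r + 1) (shiftLast s ((k + 1 : ℕ) : ℂ)) := by
  refine ⟨fun s => (∏ j : Fin r, rising (k + 1) (tail (merge s) j - ((r - (j : ℕ) : ℕ) : ℂ))) *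
    rising k (s (Fin.last r)), fun z => ?_, fun s => ?_⟩
  · refine (Finset.analyticAt_fun_prod _ fun j _ => analyticAt_rising _ ?_).mul
      (analyticAt_rising _ (analyticAt_apply _ z))
    exact (AnalyticAt.fun_comp (analyticAt_tail j (merge z)) (analyticAt_merge z)).sub
      analyticAt_const
  · rw [gammaFactor_succ, gammaFactor, gammaFactor, mul_mul_mul_comm, ← Finset.prod_mul_distrib]
    congr 1
    · refine Finset.prod_congr rfl fun j _ => ?_
      rw [one_div_Gamma_eq_rising_mul (k + 1), tail_merge, tail_merge, tail_shiftLast]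
      ring_nf
    · rw [one_div_Gamma_eq_rising_mul k]
      congr 3
      simp [shiftLast]
      ring

/-! ### Summation over the last entry -/

/-- The last entry of a tuple, with the convention for the empty tuple that makes the sum over the
next entry start at `1`. -/
def lastEntry (e : ℕ) {r : ℕ} (m : Fin r → ℕ+) : ℕ :=
  if h : 0 < r then m ⟨r - 1, by omega⟩ else 1 - e

theorem one_le_lastEntry_add {e : ℕ} (he : e ≤ 1) {r : ℕ} (m : Fin r → ℕ+) :
    1 ≤ lastEntry e m + e := by
  unfold lastEntry
  split_ifs with h
  · have := (m ⟨r - 1, by omega⟩).pos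
    omega
  · omega

theorem chain_snoc_iff {e : ℕ} (he : e ≤ 1) {r : ℕ} (m : Fin r → ℕ+) (n : ℕ+) :
    Chain e (Fin.snoc m n : Fin (r + 1) → ℕ+) ↔ Chain e m ∧ lastEntry e m + e ≤ n := by
  constructor
  · intro h
    refine ⟨fun i j hij => ?_, ?_⟩
    · have := h i.castSucc j.castSucc (Fin.castSucc_lt_castSucc_iff.2 hij)
      simpa using this
    · unfold lastEntry
      split_ifs with hr
      · have := h (Fin.castSucc ⟨r - 1, by omega⟩) (Fin.last r) (Fin.castSucc_lt_last _)
        rwa [Fin.snoc_castSucc, Fin.snoc_last] at this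
      · have := n.pos; omega
  · rintro ⟨h, hn⟩ i j hij
    have hi : i ≠ Fin.last r := (hij.trans_le (Fin.le_last j)).ne
    obtain ⟨i, rfl⟩ := Fin.exists_castSucc_eq.2 hi
    by_cases hj : j = Fin.last r
    · subst hj
      have hr : 0 < r := i.pos
      rw [lastEntry, dif_pos hr] at hn
      have h2 : (m i : ℕ) ≤ m ⟨r - 1, by omega⟩ := by
        have hi : i ≤ ⟨r - 1, by omega⟩ := Fin.le_def.2 (by
          have := i.2; simp only; omega)
        exact_mod_cast h.monotone hi
      simp only [Fin.snoc_castSucc, Fin.snoc_last]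
      omega
    · obtain ⟨j, rfl⟩ := Fin.exists_castSucc_eq.2 hj
      simpa using h i j (Fin.castSucc_lt_castSucc_iff.1 hij)

theorem term_init_mul_cpow {r : ℕ} (s : Fin (r + 1) → ℂ) (k : ℂ) (m : Fin (r + 1) → ℕ+) :
    term (Fin.init s) (Fin.init m) * ((m (Fin.last r) : ℕ) : ℂ) ^ (-s (Fin.last r) - k) =
      term (shiftLast s k) m := by
  simp [term, Fin.prod_univ_castSucc, Fin.init, shiftLast, Fin.ext_iff, (Fin.is_lt _).ne]
  left
  ring_nf

/-- The value of the sum over the next entry when the tuple is empty. -/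
def emptyValue (e r : ℕ) : ℂ := if r = 0 ∧ e = 1 then 0 else 1

/-- The power of the previous entry left by telescoping joins that entry's own power, with total
exponent `-(s_{r-1} + s_r - 1)`. For the empty tuple the base is `1 - e`, which yields `emptyValue`.
-/
theorem term_init_mul_natPow {e : ℕ} (he : e ≤ 1) {r : ℕ} (s : Fin (r + 1) → ℂ)
    (m : Fin r → ℕ+) :
    term (Fin.init s) m * natPow (lastEntry e m) (1 - s (Fin.last r)) =
      emptyValue e r * term (merge s) m := by
  rcases Nat.eq_zero_or_pos r with rfl | hr
  · interval_cases e <;> simp [term, lastEntry, natPow, emptyValue]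
  · obtain ⟨r, rfl⟩ : ∃ r', r = r' + 1 := ⟨r - 1, by omega⟩
    have hl : lastEntry e m = m (Fin.last r) := dif_pos hr
    have h1 : emptyValue e (r + 1) = 1 := by simp [emptyValue]
    have hm : ((m (Fin.last r) : ℕ) : ℂ) ≠ 0 := by exact_mod_cast (m (Fin.last r)).ne_zero
    rw [hl, natPow_pnat, h1, one_mul, term, term, Fin.prod_univ_castSucc, Fin.prod_univ_castSucc,
      mul_assoc]
    congr 1
    · refine Finset.prod_congr rfl fun i _ => ?_
      have hi : ¬ ((i.castSucc : Fin (r + 1)) : ℕ) + 1 = r + 1 := by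
        have := i.2
        rw [Fin.val_castSucc]; omega
      rw [merge, if_neg hi, add_zero]
      rfl
    · rw [← Complex.cpow_add _ _ hm, merge, if_pos (by simp)]
      congr 1
      simp only [Fin.init]
      ring

open Classical in
/-- The sum over chains of a monomial in all but the last entry times a function of the last entry
and the last argument. -/
noncomputable def lastSum (e : ℕ) {r : ℕ} (ρ : ℕ+ → ℂ → ℂ) (s : Fin (r + 1) → ℂ)
    (m : Fin (r + 1) → ℕ+) : ℂ :=
  if Chain e m then term (Fin.init s) (Fin.init m) * ρ (m (Fin.last r)) (s (Fin.last r)) else 0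

/-- The decay of `ρ` is that of the last argument increased by `K`, and this increase carries
`shiftedDomain (r + 1) K` into the domain of convergence. -/
theorem summable_and_analyticAt_lastSum (e : ℕ) {r K : ℕ} {ρ : ℕ+ → ℂ → ℂ}
    (hρ : ∀ n a, AnalyticAt ℂ (ρ n) a)
    (hb : ∀ A : ℝ, ∃ C ≥ 0, ∀ a : ℂ, ‖a‖ ≤ A → ∀ n : ℕ+,
      ‖ρ n a‖ ≤ C * ((n : ℕ) : ℝ) ^ (-a.re - K))
    {p : Fin (r + 1) → ℂ} (hp : p ∈ shiftedDomain (r + 1) K) :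
    (Summable fun m => ‖lastSum e ρ p m‖) ∧
      AnalyticAt ℂ (fun s => ∑' m, lastSum e ρ s m) p := by
  refine summable_and_analyticAt_of_le (f := fun m s => lastSum e ρ s m)
    (σ := fun i => (shiftLast p K i).re) ?_ ?_ ?_ ?_
  · have := shiftLast_mem (n := 0) K (by simp) hp
    rw [← convDomain_eq] at this
    exact this
  · intro m z
    unfold lastSum
    by_cases h : Chain e m
    · simp only [if_pos h]
      have hinit : AnalyticAt ℂ (fun s : Fin (r + 1) → ℂ => fun i : Fin r => s i.castSucc) z :=
        AnalyticAt.pi fun i => analyticAt_apply _ z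
      have hterm : AnalyticAt ℂ (fun s : Fin (r + 1) → ℂ => term (Fin.init s) (Fin.init m)) z :=
        AnalyticAt.fun_comp (g := fun s => term s (Fin.init m)) (analyticAt_term _ _) hinit
      exact hterm.mul (AnalyticAt.fun_comp (hρ _ _) (analyticAt_apply _ z))
    · simp only [if_neg h]; exact analyticAt_const
  · intro m z hm
    exact if_neg fun h => hm h.monotone
  · intro η hη
    obtain ⟨C, hC, h⟩ := hb (‖p‖ + η)
    refine ⟨C, hC, fun m z hz => ?_⟩
    unfold lastSum
    split_ifs
    · rw [norm_mul, norm_term, Fin.prod_univ_castSucc, ← mul_assoc, mul_comm C, mul_assoc]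
      refine mul_le_mul ?_ ?_ (norm_nonneg _) (Finset.prod_nonneg fun _ _ => by positivity)
      · refine Finset.prod_le_prod (fun i _ => by positivity) fun i _ => pnat_rpow_le _ ?_
        have := abs_lt.1 (abs_re_sub_lt_of_mem_ball hη hz i.castSucc)
        simp only [shiftLast, Fin.init, if_neg (Fin.castSucc_lt_last i).ne, add_zero]
        linarith
      · refine (h _ ?_ _).trans (mul_le_mul_of_nonneg_left (pnat_rpow_le _ ?_) hC)
        · rw [mem_ball, dist_eq_norm] at hz
          calc ‖z (Fin.last r)‖ ≤ ‖z‖ := norm_le_pi_norm z _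
            _ = ‖p + (z - p)‖ := by rw [add_sub_cancel]
            _ ≤ ‖p‖ + ‖z - p‖ := norm_add_le _ _
            _ ≤ ‖p‖ + η := by linarith
        · have := abs_lt.1 (abs_re_sub_lt_of_mem_ball hη hz (Fin.last r))
          simp only [shiftLast, if_pos, Complex.add_re, Complex.natCast_re]
          linarith
    · rw [norm_zero]; positivity

theorem tsum_lastSum_powDiff {e : ℕ} (he : e ≤ 1) {r : ℕ} {s : Fin (r + 1) → ℂ}
    (hs : s ∈ convDomain (r + 1)) (hsum : Summable fun m => lastSum e (powDiff e) s m) :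
    ∑' m, lastSum e (powDiff e) s m = emptyValue e r * chainSeries e r (merge s) := by
  classical
  set E := Fin.snocEquiv (fun _ : Fin (r + 1) => ℕ+) with hE
  have hval : ∀ q : (Fin r → ℕ+) × ℕ+, lastSum e (powDiff e) s (E q.swap) =
      (if Chain e q.1 then term (Fin.init s) q.1 else 0) *
        (if lastEntry e q.1 + e ≤ q.2 then powDiff e q.2 (s (Fin.last r)) else 0) := by
    rintro ⟨m, n⟩
    have h1 : E (n, m) = (Fin.snoc m n : Fin (r + 1) → ℕ+) := rfl
    simp only [Prod.swap_prod_mk, h1, lastSum, chain_snoc_iff he, Fin.init_snoc, Fin.snoc_last]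
    by_cases hc : Chain e m <;> by_cases hl : lastEntry e m + e ≤ n <;> simp [hc, hl]
  have hsum' : Summable fun q : (Fin r → ℕ+) × ℕ+ => lastSum e (powDiff e) s (E q.swap) :=
    hsum.comp_injective (E.injective.comp Prod.swap_injective)
  rw [← ((Equiv.prodComm _ _).trans E).tsum_eq]
  simp only [Equiv.trans_apply, Equiv.prodComm_apply]
  rw [hsum'.tsum_prod, chainSeries, ← tsum_mul_left]
  refine tsum_congr fun m => ?_
  by_cases hc : Chain e m
  -- Fubini gives summability of the inner series only with its prefactor, which must be nonzero to
  -- be cancelled.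
  · have hterm : term (Fin.init s) m ≠ 0 := by
      refine Finset.prod_ne_zero_iff.2 fun i _ => ?_
      rw [Complex.cpow_def_of_ne_zero (by exact_mod_cast (m i).ne_zero)]
      exact Complex.exp_ne_zero _
    have hinner := hsum'.prod_factor m
    simp only [hval, if_pos hc] at hinner ⊢
    rw [tsum_mul_left, tsum_powDiff (one_le_lastEntry_add he m) (one_lt_re_last hs)
      ((summable_mul_left_iff hterm).1 hinner), term_init_mul_natPow he]
  · simp only [Prod.forall, Prod.swap_prod_mk] at hval ⊢
    simp [hval, hc]

theorem lastSum_cpow (e : ℕ) {r : ℕ} (s : Fin (r + 1) → ℂ) (k : ℂ) (m : Fin (r + 1) → ℕ+) :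
    lastSum e (fun n a => ((n : ℕ) : ℂ) ^ (-a - k)) s m =
      open Classical in if Chain e m then term (shiftLast s k) m else 0 := by
  unfold lastSum
  split_ifs
  · rw [term_init_mul_cpow]
  · rfl

/-- Double induction, on the depth `r` and on the number `n` of unit steps to the left. The
recursion `hrec` determines `(s_r - 1)` times the series from depth `r`, shifts by at least 1, and a
remainder converging on the larger region. The Gamma factor supplies `s_r - 1` and clears the poles
of the other terms. -/
theorem exists_entire_gammaFactor_mul {e : ℕ} (he : e ≤ 1) (r : ℕ) :
    ∃ G : (Fin r → ℂ) → ℂ, (∀ z, AnalyticAt ℂ G z) ∧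
      EqOn G (fun s => gammaFactor r s * chainSeries e r s) (convDomain r) := by
  classical
  induction r with
  | zero =>
    refine ⟨fun _ => gammaFactor 0 0 * chainSeries e 0 0, fun _ => analyticAt_const, fun s _ => ?_⟩
    rw [Subsingleton.elim s 0]
  | succ r ih =>
    obtain ⟨G₀, hG₀, hG₀'⟩ := ih
    obtain ⟨d, hd, hd0, hdb⟩ := exists_powDiff_expansion he
    refine exists_entire_of_forall_shiftedDomain fun n => ?_
    induction n with
    | zero =>
      refine ⟨fun s => gammaFactor (r + 1) s * chainSeries e (r + 1) s, fun z hz => ?_,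
        fun s _ => rfl⟩
      rw [← convDomain_eq] at hz
      exact (analyticAt_gammaFactor _ z).mul (summable_and_analyticAt_chain e hz).2
    | succ n ihn =>
      obtain ⟨G₁, hG₁, hG₁'⟩ := ihn
      choose q hq hq' using exists_gammaFactor_shiftLast r
      set ρ : ℕ → ℕ+ → ℂ → ℂ := fun K m a => powDiff e m a -
        ∑ k ∈ Finset.range K, d k a * ((m : ℕ) : ℂ) ^ (-a - k) with hρdef
      have hρ : ∀ K m a, AnalyticAt ℂ (ρ K m) a := fun K m a =>
        (analyticAt_powDiff e m a).sub (Finset.analyticAt_fun_sum _ fun k _ =>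
          (hd k a).mul (analyticAt_pnat_cpow m (analyticAt_id.neg.sub analyticAt_const)))
      have hP : ∀ K, ∀ p ∈ shiftedDomain (r + 1) K, _ := fun K p hp =>
        summable_and_analyticAt_lastSum e (hρ K) (hdb K) hp
      have hdec : ∀ (K : ℕ) (s : Fin (r + 1) → ℂ) (m : Fin (r + 1) → ℕ+),
          lastSum e (powDiff e) s m = lastSum e (ρ K) s m + ∑ k ∈ Finset.range K,
            d k (s (Fin.last r)) *
              (if Chain e m then term (shiftLast s (k : ℂ)) m else 0) := by
        intro K s m
        simp only [← lastSum_cpow, lastSum, hρdef]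
        split_ifs
        · simp only [mul_sub, Finset.mul_sum, mul_left_comm, sub_add_cancel]
        · simp
      have hsumk : ∀ s ∈ convDomain (r + 1), ∀ k : ℕ, Summable fun m : Fin (r + 1) → ℕ+ =>
          d k (s (Fin.last r)) * (if Chain e m then term (shiftLast s (k : ℂ)) m else 0) := by
        intro s hs k
        refine Summable.mul_left _ (Summable.of_norm (summable_and_analyticAt_chain e ?_).1)
        rw [convDomain_eq] at hs ⊢
        exact shiftLast_mem k (Nat.zero_le _) hs
      have hsumP : ∀ s ∈ convDomain (r + 1), ∀ K, Summable fun m => lastSum e (ρ K) s m :=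
        fun s hs K => (hP K s (convDomain_subset _ _ hs)).1.of_norm
      -- Sum the expansion of `powDiff` to order `n + 1` over all chains: the term `k = 0` is the
      -- left side because `d 0 a = a - 1`, and `powDiff` itself telescopes.
      have hrec : ∀ s ∈ convDomain (r + 1),
          (s (Fin.last r) - 1) * chainSeries e (r + 1) s =
            emptyValue e r * chainSeries e r (merge s) - ∑ k ∈ Finset.range n,
              d (k + 1) (s (Fin.last r)) *
                chainSeries e (r + 1) (shiftLast s ((k + 1 : ℕ) : ℂ)) -
              ∑' m, lastSum e (ρ (n + 1)) s m := by
        intro s hs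
        have h1 : Summable fun m => lastSum e (powDiff e) s m := by
          simp only [hdec (n + 1) s]
          exact (hsumP s hs _).add (summable_sum fun k _ => hsumk s hs k)
        rw [← tsum_lastSum_powDiff he hs h1]
        simp only [hdec (n + 1) s]
        rw [(hsumP s hs _).tsum_add (summable_sum fun k _ => hsumk s hs k),
          Summable.tsum_finsetSum fun k _ => hsumk s hs k, Finset.sum_range_succ']
        simp only [tsum_mul_left, hd0]
        have h2 : shiftLast s ((0 : ℕ) : ℂ) = s := by
          funext i; simp [shiftLast]
        rw [h2]
        simp only [chainSeries]
        ring
      -- This is the right side of `hrec` times the Gamma factor without `s_r - 1`, with each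
      -- product of Gamma factor and series replaced by its known extension.
      refine ⟨fun s => (Complex.Gamma (s (Fin.last r)))⁻¹ * emptyValue e r * G₀ (merge s) -
        ∑ k ∈ Finset.range n, d (k + 1) (s (Fin.last r)) * (q k s *
          G₁ (shiftLast s ((k + 1 : ℕ) : ℂ))) -
        gammaFactor r (merge s) * (Complex.Gamma (s (Fin.last r)))⁻¹ *
          ∑' m, lastSum e (ρ (n + 1)) s m, fun z hz => ?_, fun s hs => ?_⟩
      · have hl : AnalyticAt ℂ (fun s : Fin (r + 1) → ℂ => s (Fin.last r)) z :=
          analyticAt_apply _ z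
        have hΓ := analyticAt_one_div_Gamma hl
        refine (((hΓ.mul analyticAt_const).mul
          (AnalyticAt.fun_comp (hG₀ _) (analyticAt_merge z))).sub
          (Finset.analyticAt_fun_sum _ fun k _ => ?_)).sub
          (((AnalyticAt.fun_comp (analyticAt_gammaFactor r _) (analyticAt_merge z)).mul hΓ).mul
            (hP _ z hz).2)
        refine (AnalyticAt.fun_comp (hd _ _) hl).mul ((hq k z).mul
          (AnalyticAt.fun_comp (hG₁ _ ?_) (analyticAt_shiftLast _ z)))
        exact shiftLast_mem (k + 1) (by omega) hz
      · simp only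
        have h3 : ∀ k ∈ Finset.range n, d (k + 1) (s (Fin.last r)) * (q k s *
            G₁ (shiftLast s ((k + 1 : ℕ) : ℂ))) =
            gammaFactor r (merge s) * (Complex.Gamma (s (Fin.last r)))⁻¹ *
              (d (k + 1) (s (Fin.last r)) *
                chainSeries e (r + 1) (shiftLast s ((k + 1 : ℕ) : ℂ))) := by
          intro k _
          have hmem : shiftLast s ((k + 1 : ℕ) : ℂ) ∈ convDomain (r + 1) := by
            rw [convDomain_eq] at hs ⊢
            exact shiftLast_mem (k + 1) (Nat.zero_le _) hs
          rw [hG₁' hmem, hq' k s]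
          ring
        rw [Finset.sum_congr rfl h3, ← Finset.mul_sum, gammaFactor_succ', mul_assoc _ (_ - 1),
          hrec s hs, hG₀' (merge_mem_convDomain hs)]
        ring

/-! ### Uniqueness of the continuation -/

theorem eq_zero_of_frequently_eq_zero {E : Type*} [TopologicalSpace E] {ψ : E → ℂ} {w : E}
    (hψ : ContinuousAt ψ w) (h : ∃ᶠ z in 𝓝 w, ψ z = 0) : ψ w = 0 := by
  by_contra hne
  exact h (hψ.eventually_ne hne)

/-- A connectedness argument. The set where the identity holds locally is open by definition and
contains `D`. At a limit point write `F = g / h`: the analytic function `H g - G h` vanishes near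
some point of a ball, hence on the whole ball. -/
theorem mul_eq_of_isMeromorphicContinuation {r : ℕ} {D : Set (Fin r → ℂ)} (hD : IsOpen D)
    (hDne : D.Nonempty) {f F G H : (Fin r → ℂ) → ℂ} (hG : ∀ z, AnalyticAt ℂ G z)
    (hH : ∀ z, AnalyticAt ℂ H z) (hGf : EqOn G (fun s => H s * f s) D)
    (hF : IsMeromorphicContinuation D f F) (z : Fin r → ℂ) (hz : AnalyticAt ℂ F z) :
    H z * F z = G z := by
  set V : Set (Fin r → ℂ) := {p | ∀ᶠ z in 𝓝 p, AnalyticAt ℂ F z → H z * F z = G z} with hV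
  suffices h : V = univ by
    have : z ∈ V := h ▸ mem_univ z
    exact Eventually.self_of_nhds this hz
  refine IsClopen.eq_univ ⟨?_, isOpen_setOfPred_eventually_nhds⟩ ?_
  swap
  · obtain ⟨p, hp⟩ := hDne
    refine ⟨p, ?_⟩
    filter_upwards [hD.mem_nhds hp] with w hw _
    rw [hF.2 hw, hGf hw]
  refine isClosed_of_closure_subset fun p hp => ?_
  obtain ⟨g, h, hg, hh, hne, hgh⟩ := hF.1 p
  obtain ⟨ε, hε, hB⟩ := Metric.eventually_nhds_iff_ball.1
    ((hg.eventually_analyticAt.and hh.eventually_analyticAt).and hgh)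
  have hBp : IsPreconnected (ball p ε) := (convex_ball p ε).isPreconnected
  have hnot : ∀ w ∈ ball p ε, ∃ᶠ u in 𝓝 w, h u ≠ 0 := by
    intro w hw
    rw [Filter.Frequently]
    intro hcon
    refine hne ?_
    have h0 : h =ᶠ[𝓝 w] fun _ => 0 := by
      filter_upwards [hcon] with u hu
      exact not_not.1 hu
    have heq := AnalyticOnNhd.eqOn_of_preconnected_of_eventuallyEq
      (fun u hu => (hB u hu).1.2) (fun u _ => analyticAt_const) hBp hw h0
    filter_upwards [ball_mem_nhds p hε] with u hu using heq hu
  obtain ⟨q, hqB, hqV⟩ := mem_closure_iff.1 hp _ isOpen_ball (mem_ball_self hε)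
  -- A point of the ball at which the identity already holds locally and `h` does not vanish; near
  -- it `F` is analytic, so the identity applies there unconditionally.
  obtain ⟨v, hv0, hvV, hvB⟩ := ((hnot q hqB).and_eventually
    ((eventually_eventually_nhds.2 hqV).and (isOpen_ball.mem_nhds hqB))).exists
  have hFan : ∀ w ∈ ball p ε, h w ≠ 0 → AnalyticAt ℂ F w := by
    intro w hw hw0
    refine ((hB w hw).1.1.div (hB w hw).1.2 hw0).congr ?_
    filter_upwards [isOpen_ball.mem_nhds hw, (hB w hw).1.2.continuousAt.eventually_ne hw0]
      with u hu hu0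
    exact ((hB u hu).2 hu0).symm
  have hφ0 : (fun w => H w * g w - G w * h w) =ᶠ[𝓝 v] fun _ => 0 := by
    filter_upwards [hvV, isOpen_ball.mem_nhds hvB,
      (hB v hvB).1.2.continuousAt.eventually_ne hv0] with w hw hwB hw0
    have := hw (hFan w hwB hw0)
    rw [(hB w hwB).2 hw0, ← mul_div_assoc, div_eq_iff hw0] at this
    rw [this, sub_self]
  have hφ := AnalyticOnNhd.eqOn_of_preconnected_of_eventuallyEq
    (fun u hu => ((hH u).mul (hB u hu).1.1).sub ((hG u).mul (hB u hu).1.2))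
    (fun u _ => analyticAt_const) hBp hvB hφ0
  filter_upwards [ball_mem_nhds p hε] with w hw hFw
  -- The values of `F` on the zeros of `h` are arbitrary, so at points where `F` is analytic the
  -- identity is recovered by continuity from nearby points with `h ≠ 0`.
  refine sub_eq_zero.1 (eq_zero_of_frequently_eq_zero (ψ := fun w => H w * F w - G w)
    (((hH w).mul hFw).sub (hG w)).continuousAt ?_)
  refine ((hnot w hw).and_eventually (isOpen_ball.mem_nhds hw)).mono fun u hu => ?_
  have := hφ hu.2
  simp only at this
  rw [(hB u hu.2).2 hu.1, ← mul_div_assoc, sub_eq_zero, div_eq_iff hu.1]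
  exact sub_eq_zero.1 this

theorem frequently_ne_zero {E : Type*} [NormedAddCommGroup E] [NormedSpace ℂ E] {H : E → ℂ}
    (hH : ∀ z, AnalyticAt ℂ H z) {z₀ : E} (h0 : H z₀ ≠ 0) (z : E) : ∃ᶠ w in 𝓝 z, H w ≠ 0 := by
  rw [Filter.Frequently]
  intro hcon
  have h1 : H =ᶠ[𝓝 z] fun _ => 0 := by
    filter_upwards [hcon] with u hu
    exact not_not.1 hu
  exact h0 (AnalyticOnNhd.eqOn_of_preconnected_of_eventuallyEq (f := H) (g := fun _ => 0)
    (U := univ) (fun u _ => hH u) (fun u _ => analyticAt_const) isPreconnected_univ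
    (mem_univ z) h1 (mem_univ z₀))

theorem isMeromorphicContinuation_div {r : ℕ} {f G H : (Fin r → ℂ) → ℂ}
    (hG : ∀ z, AnalyticAt ℂ G z) (hH : ∀ z, AnalyticAt ℂ H z)
    (hH0 : ∀ z ∈ convDomain r, H z ≠ 0) (hGf : EqOn G (fun s => H s * f s) (convDomain r)) :
    IsMeromorphicContinuation (convDomain r) f (fun z => G z / H z) := by
  refine ⟨fun p => ⟨G, H, hG p, hH p, fun h0 => ?_, Eventually.of_forall fun _ _ => rfl⟩,
    fun z hz => ?_⟩
  · obtain ⟨z, hz⟩ := convDomain_nonempty r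
    exact frequently_ne_zero hH (hH0 z hz) p (h0.mono fun _ h => not_not.2 h)
  · simp only
    rw [hGf hz, mul_div_cancel_left₀ _ (hH0 z hz)]

theorem continuation_eq_div {r : ℕ} {f G H : (Fin r → ℂ) → ℂ}
    (hG : ∀ z, AnalyticAt ℂ G z) (hH : ∀ z, AnalyticAt ℂ H z)
    (hH0 : ∀ z ∈ convDomain r, H z ≠ 0) (hGf : EqOn G (fun s => H s * f s) (convDomain r))
    {z : Fin r → ℂ} (hz : H z ≠ 0) :
    continuation (convDomain r) f z = G z / H z := by
  have hex : ∃ F : (Fin r → ℂ) → ℂ, IsMeromorphicContinuation (convDomain r) f F ∧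
      AnalyticAt ℂ F z :=
    ⟨_, isMeromorphicContinuation_div hG hH hH0 hGf, (hG z).div (hH z) hz⟩
  rw [continuation, dif_pos hex, eq_div_iff hz, mul_comm]
  exact mul_eq_of_isMeromorphicContinuation (isOpen_convDomain r) (convDomain_nonempty r) hG hH
    hGf hex.choose_spec.1 z hex.choose_spec.2

theorem isMeromorphicContinuation_continuation {r : ℕ} {f G H : (Fin r → ℂ) → ℂ}
    (hG : ∀ z, AnalyticAt ℂ G z) (hH : ∀ z, AnalyticAt ℂ H z)
    (hH0 : ∀ z ∈ convDomain r, H z ≠ 0) (hGf : EqOn G (fun s => H s * f s) (convDomain r)) :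
    IsMeromorphicContinuation (convDomain r) f (continuation (convDomain r) f) := by
  refine ⟨fun p => ?_, fun z hz => ?_⟩
  · refine ⟨G, H, hG p, hH p, fun h0 => ?_, Eventually.of_forall fun z hz =>
      continuation_eq_div hG hH hH0 hGf hz⟩
    obtain ⟨z, hz⟩ := convDomain_nonempty r
    exact frequently_ne_zero hH (hH0 z hz) p (h0.mono fun _ h => not_not.2 h)
  · rw [continuation_eq_div hG hH hH0 hGf (hH0 z hz), hGf hz, mul_div_cancel_left₀ _ (hH0 z hz)]

theorem chain_continuation {e : ℕ} (he : e ≤ 1) (r : ℕ) :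
    IsMeromorphicContinuation (convDomain r) (chainSeries e r)
        (continuation (convDomain r) (chainSeries e r)) ∧
      ∃ G H : (Fin r → ℂ) → ℂ, (∀ z, AnalyticAt ℂ G z) ∧ (∀ z, AnalyticAt ℂ H z) ∧
        (∀ z ∈ convDomain r, H z ≠ 0) ∧
        ∀ z, H z ≠ 0 → continuation (convDomain r) (chainSeries e r) z = G z / H z := by
  obtain ⟨G, hG, hGf⟩ := exists_entire_gammaFactor_mul he r
  have hH := analyticAt_gammaFactor r
  have hH0 : ∀ z ∈ convDomain r, gammaFactor r z ≠ 0 := fun z hz => gammaFactor_ne_zero hz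
  exact ⟨isMeromorphicContinuation_continuation hG hH hH0 hGf, G, gammaFactor r, hG, hH, hH0,
    fun z hz => continuation_eq_div hG hH hH0 hGf hz⟩

theorem zetaEZ_eq (r : ℕ) : zetaEZ r = continuation (convDomain r) (chainSeries 1 r) := by
  rw [zetaEZ, funext (ezSeries_eq r)]

theorem zetaEZStar_eq (r : ℕ) : zetaEZStar r = continuation (convDomain r) (chainSeries 0 r) := by
  rw [zetaEZStar, funext (ezStarSeries_eq r)]

theorem isMeromorphicContinuation_zeta (r : ℕ) :
    IsMeromorphicContinuation (convDomain r) (ezSeries r) (zetaEZ r) ∧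
      IsMeromorphicContinuation (convDomain r) (ezStarSeries r) (zetaEZStar r) := by
  rw [zetaEZ_eq, zetaEZStar_eq, funext (ezSeries_eq r), funext (ezStarSeries_eq r)]
  exact ⟨(chain_continuation le_rfl r).1, (chain_continuation zero_le_one r).1⟩

/-! ### Quotients of entire functions -/

section Quotient

variable {E : Type*} [NormedAddCommGroup E] [NormedSpace ℂ E]

/-- `F` is a quotient of entire functions away from the zeros of the denominator. -/
def IsEntireQuotient (F : E → ℂ) : Prop :=
  ∃ G H : E → ℂ, (∀ z, AnalyticAt ℂ G z) ∧ (∀ z, AnalyticAt ℂ H z) ∧ (∃ z, H z ≠ 0) ∧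
    ∀ z, H z ≠ 0 → F z = G z / H z

theorem exists_mul_ne_zero {H₁ H₂ : E → ℂ} (h₁ : ∀ z, AnalyticAt ℂ H₁ z)
    (h₂ : ∀ z, AnalyticAt ℂ H₂ z) (h₁' : ∃ z, H₁ z ≠ 0) (h₂' : ∃ z, H₂ z ≠ 0) :
    ∃ z, H₁ z * H₂ z ≠ 0 := by
  obtain ⟨z₁, hz₁⟩ := h₁'
  obtain ⟨z₂, hz₂⟩ := h₂'
  obtain ⟨w, hw, hw'⟩ := ((frequently_ne_zero h₂ hz₂ z₁).and_eventually
    ((h₁ z₁).continuousAt.eventually_ne hz₁)).exists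
  exact ⟨w, mul_ne_zero hw' hw⟩

theorem IsEntireQuotient.const (c : ℂ) : IsEntireQuotient (fun _ : E => c) :=
  ⟨fun _ => c, fun _ => 1, fun _ => analyticAt_const, fun _ => analyticAt_const,
    ⟨0, one_ne_zero⟩, fun _ _ => by simp⟩

theorem IsEntireQuotient.mul {F₁ F₂ : E → ℂ} (h₁ : IsEntireQuotient F₁)
    (h₂ : IsEntireQuotient F₂) : IsEntireQuotient (fun z => F₁ z * F₂ z) := by
  obtain ⟨G₁, H₁, hG₁, hH₁, hn₁, he₁⟩ := h₁
  obtain ⟨G₂, H₂, hG₂, hH₂, hn₂, he₂⟩ := h₂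
  refine ⟨fun z => G₁ z * G₂ z, fun z => H₁ z * H₂ z, fun z => (hG₁ z).mul (hG₂ z),
    fun z => (hH₁ z).mul (hH₂ z), exists_mul_ne_zero hH₁ hH₂ hn₁ hn₂, fun z hz => ?_⟩
  beta_reduce at hz ⊢
  rw [he₁ z (left_ne_zero_of_mul hz), he₂ z (right_ne_zero_of_mul hz), div_mul_div_comm]

theorem IsEntireQuotient.add {F₁ F₂ : E → ℂ} (h₁ : IsEntireQuotient F₁)
    (h₂ : IsEntireQuotient F₂) : IsEntireQuotient (fun z => F₁ z + F₂ z) := by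
  obtain ⟨G₁, H₁, hG₁, hH₁, hn₁, he₁⟩ := h₁
  obtain ⟨G₂, H₂, hG₂, hH₂, hn₂, he₂⟩ := h₂
  refine ⟨fun z => G₁ z * H₂ z + H₁ z * G₂ z, fun z => H₁ z * H₂ z,
    fun z => ((hG₁ z).mul (hH₂ z)).add ((hH₁ z).mul (hG₂ z)),
    fun z => (hH₁ z).mul (hH₂ z), exists_mul_ne_zero hH₁ hH₂ hn₁ hn₂, fun z hz => ?_⟩
  beta_reduce at hz ⊢
  rw [he₁ z (left_ne_zero_of_mul hz), he₂ z (right_ne_zero_of_mul hz),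
    div_add_div _ _ (left_ne_zero_of_mul hz) (right_ne_zero_of_mul hz)]

theorem IsEntireQuotient.sum {ι : Type*} (t : Finset ι) {F : ι → E → ℂ}
    (h : ∀ i ∈ t, IsEntireQuotient (F i)) : IsEntireQuotient (fun z => ∑ i ∈ t, F i z) := by
  classical
  induction t using Finset.induction_on with
  | empty => simpa using IsEntireQuotient.const 0
  | insert a t ha ih =>
    simp only [Finset.sum_insert ha]
    exact (h a (Finset.mem_insert_self a t)).add
      (ih fun i hi => h i (Finset.mem_insert_of_mem hi))

/-- The product `G * H` vanishes on `U`, even at the zeros of `H`, hence everywhere. So `F` is zero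
off the zeros of `H`, and such points accumulate at `s`. -/
theorem IsEntireQuotient.eq_zero {F : E → ℂ} (h : IsEntireQuotient F) {U : Set E} (hU : IsOpen U)
    (hUne : U.Nonempty) (h0 : ∀ z ∈ U, F z = 0) {s : E} (hs : ContinuousAt F s) : F s = 0 := by
  obtain ⟨G, H, hG, hH, ⟨z₀, hz₀⟩, he⟩ := h
  obtain ⟨u, hu⟩ := hUne
  have h1 : (fun z => G z * H z) =ᶠ[𝓝 u] fun _ => 0 := by
    filter_upwards [hU.mem_nhds hu] with z hz
    by_cases hz0 : H z = 0
    · rw [hz0, mul_zero]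
    · have := he z hz0
      rw [h0 z hz, eq_comm, div_eq_zero_iff, or_iff_left hz0] at this
      rw [this, zero_mul]
  have h2 := AnalyticOnNhd.eqOn_of_preconnected_of_eventuallyEq (f := fun z => G z * H z)
    (g := fun _ => 0) (U := univ) (fun z _ => (hG z).mul (hH z)) (fun u _ => analyticAt_const)
    isPreconnected_univ (mem_univ u) h1
  refine eq_zero_of_frequently_eq_zero hs ((frequently_ne_zero hH hz₀ s).mono fun z hz => ?_)
  have h3 : G z * H z = 0 := h2 (mem_univ z)
  rw [he z hz, (mul_eq_zero.1 h3).resolve_right hz, zero_div]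

/-- One point sent by `L` into the domain of convergence ensures that the denominator does not
vanish identically after the substitution. -/
theorem isEntireQuotient_chain {e : ℕ} (he : e ≤ 1) {r : ℕ} {L : E → Fin r → ℂ}
    (hL : ∀ z, AnalyticAt ℂ L z) (hz : ∃ z, L z ∈ convDomain r) :
    IsEntireQuotient (fun z => continuation (convDomain r) (chainSeries e r) (L z)) := by
  obtain ⟨-, G, H, hG, hH, hH0, heq⟩ := chain_continuation he r
  obtain ⟨z, hz⟩ := hz
  exact ⟨fun z => G (L z), fun z => H (L z), fun z => AnalyticAt.fun_comp (hG _) (hL z),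
    fun z => AnalyticAt.fun_comp (hH _) (hL z), ⟨z, hH0 _ hz⟩, fun z hz => heq _ hz⟩

end Quotient

/-! ### The tuples `t ≼ T` as ordered set partitions -/

/-- Only the blocks matter, not the labelling `f` that produced them: what survives is the block
index `N`. Rows are weak because `f` increases along them; columns are strict because a block may
not contain two boxes of one column. -/
theorem Preceq.exists_blockIndex {θ : Finset (ℕ × ℕ)} {m : ℕ} {w : Fin m → Finset θ}
    (hw : Preceq θ m w) :
    ∃ N : θ → Fin m, Function.Surjective N ∧
      (∀ c d : θ, c.1.1 = d.1.1 → c.1.2 < d.1.2 → N c ≤ N d) ∧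
      (∀ c d : θ, c.1.2 = d.1.2 → c.1.1 < d.1.1 → N c < N d) ∧
      ∀ a c, c ∈ w a ↔ N c = a := by
  obtain ⟨f, ⟨hrow, hcol⟩, h, l, hh, hmem, hblk, hdisj, hcov⟩ := hw
  have hex : ∀ c : θ, ∃ a, c ∈ w a := by
    intro c
    have h1 : (f c : ℕ) ∈ Finset.range θ.card := Finset.mem_range.2 (f c).2
    rw [← hcov, Finset.mem_biUnion] at h1
    obtain ⟨a, -, ha⟩ := h1
    exact ⟨a, (hmem a c).2 (Finset.mem_Icc.1 ha)⟩
  choose N hN using hex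
  have hun : ∀ a c, c ∈ w a → N c = a := by
    intro a c hc
    by_contra hne
    exact Finset.disjoint_left.1 (hdisj hne) (Finset.mem_Icc.2 ((hmem _ c).1 (hN c)))
      (Finset.mem_Icc.2 ((hmem a c).1 hc))
  have hle : ∀ c d : θ, f c < f d → N c ≤ N d := by
    intro c d hcd
    by_contra hlt
    rw [not_le] at hlt
    have h1 := (hmem _ c).1 (hN c)
    have h2 := (hmem _ d).1 (hN d)
    have h3 := hh hlt
    have h4 : (f c : ℕ) < f d := hcd
    refine Finset.disjoint_left.1 (hdisj hlt.ne) (Finset.mem_Icc.2 ⟨h3.le, ?_⟩)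
      (Finset.mem_Icc.2 ⟨le_rfl, Nat.le_add_right _ _⟩)
    omega
  refine ⟨N, fun a => ?_, fun c d h1 h2 => hle c d ((hrow c d h1).2 h2), fun c d h1 h2 => ?_,
    fun a c => ⟨hun a c, fun h => h ▸ hN c⟩⟩
  · have h1 : h a ∈ Finset.range θ.card := by
      rw [← hcov, Finset.mem_biUnion]
      exact ⟨a, Finset.mem_univ a, Finset.mem_Icc.2 ⟨le_rfl, Nat.le_add_right _ _⟩⟩
    refine ⟨f.symm ⟨h a, Finset.mem_range.1 h1⟩, hun a _ ((hmem a _).2 ?_)⟩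
    simp
  · refine (hle c d ((hcol c d h1).2 h2)).lt_of_ne fun heq => ?_
    exact hblk (N c) ⟨c, hN c, d, heq ▸ hN d, h2.ne, h1⟩

theorem exists_equiv_fin_of_injective {θ : Finset (ℕ × ℕ)} {K : Type*} [LinearOrder K]
    (key : θ → K) (hkey : Function.Injective key) :
    ∃ f : θ ≃ Fin θ.card, ∀ c d, f c < f d ↔ key c < key d := by
  classical
  have hcard : (Finset.univ.image key).card = θ.card := by
    rw [Finset.card_image_of_injective _ hkey, Finset.card_univ, Fintype.card_coe]
  set o := (Finset.univ.image key).orderIsoOfFin hcard with ho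
  have hm : ∀ c, key c ∈ Finset.univ.image key := fun c =>
    Finset.mem_image_of_mem _ (Finset.mem_univ c)
  have hlt : ∀ c d, o.symm ⟨key c, hm c⟩ < o.symm ⟨key d, hm d⟩ ↔ key c < key d := fun c d => by
    rw [o.symm.lt_iff_lt, Subtype.mk_lt_mk]
  have hinj : Function.Injective fun c => o.symm ⟨key c, hm c⟩ := by
    intro c d hcd
    exact hkey (congrArg Subtype.val (o.symm.injective hcd))
  have hbij : Function.Bijective fun c => o.symm ⟨key c, hm c⟩ :=
    (Fintype.bijective_iff_injective_and_card _).2 ⟨hinj, by simp⟩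
  exact ⟨Equiv.ofBijective _ hbij, fun c d => hlt c d⟩

theorem card_filter_lt {θ : Finset (ℕ × ℕ)} (f : θ ≃ Fin θ.card) (c : θ) :
    (Finset.univ.filter fun d => f d < f c).card = f c := by
  have : (Finset.univ.filter fun d => f d < f c) = (Finset.Iio (f c)).map f.symm.toEmbedding := by
    ext d; simp
  rw [this, Finset.card_map, Fin.card_Iio]

theorem preceq_of_blockIndex {θ : Finset (ℕ × ℕ)} {m : ℕ} {w : Fin m → Finset θ} {N : θ → Fin m}
    (hN : Function.Surjective N)
    (hrow : ∀ c d : θ, c.1.1 = d.1.1 → c.1.2 < d.1.2 → N c ≤ N d)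
    (hcol : ∀ c d : θ, c.1.2 = d.1.2 → c.1.1 < d.1.1 → N c < N d)
    (hw : ∀ a c, c ∈ w a ↔ N c = a) : Preceq θ m w := by
  classical
  have hcol' : ∀ c d : θ, N c = N d → c.1.2 = d.1.2 → c = d := by
    intro c d h1 h2
    rcases lt_trichotomy c.1.1 d.1.1 with h | h | h
    · exact absurd h1 (hcol c d h2 h).ne
    · exact Subtype.ext (Prod.ext h h2)
    · exact absurd h1.symm (hcol d c h2.symm h).ne
  -- A labelling is rebuilt by sorting boxes by block, then by column; the key is injective because
  -- a block meets each column at most once.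
  obtain ⟨f, hf⟩ := exists_equiv_fin_of_injective (fun c : θ => toLex (N c, c.1.2)) (by
    intro c d h
    have h' := toLex.injective h
    exact hcol' c d (Prod.ext_iff.1 h').1 (Prod.ext_iff.1 h').2)
  simp only [Prod.Lex.toLex_lt_toLex] at hf
  have hlt : ∀ c d, N c < N d → f c < f d := fun c d h => (hf c d).2 (Or.inl h)
  have hle : ∀ c d, f c ≤ f d → N c ≤ N d := fun c d h => by
    by_contra h'
    exact absurd (hlt d c (not_le.1 h')) (not_lt.2 h)
  -- The block `a` starts after all boxes of earlier blocks, and `z a` is its size; the interval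
  -- thus has `l a = z a - 1`.
  set h : Fin m → ℕ := fun a => (Finset.univ.filter fun d => N d < a).card with hh
  set z : Fin m → ℕ := fun a => (Finset.univ.filter fun d => N d = a).card with hz
  have hz0 : ∀ a, 0 < z a := fun a => by
    obtain ⟨c, hc⟩ := hN a
    exact Finset.card_pos.2 ⟨c, by simp [hc]⟩
  have hhz : ∀ a, h a + z a = (Finset.univ.filter fun d => N d ≤ a).card := by
    intro a
    rw [hh, hz, ← Finset.card_union_of_disjoint]
    · congr 1
      ext d
      simp [le_iff_lt_or_eq]
    · rw [Finset.disjoint_filter]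
      exact fun d _ h1 h2 => h1.ne h2
  have key : ∀ a c, N c = a ↔ h a ≤ f c ∧ (f c : ℕ) ≤ h a + (z a - 1) := by
    intro a c
    have hz1 := hz0 a
    rw [← card_filter_lt f c]
    constructor
    · rintro rfl
      refine ⟨Finset.card_le_card fun d hd => ?_, ?_⟩
      · simp only [Finset.mem_filter, Finset.mem_univ, true_and] at hd ⊢
        exact hlt d c hd
      · rw [← Nat.add_sub_assoc hz1, hhz, Nat.le_sub_one_iff_lt (by rw [← hhz]; omega)]
        refine Finset.card_lt_card ⟨fun d hd => ?_, fun hsub => ?_⟩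
        · simp only [Finset.mem_filter, Finset.mem_univ, true_and] at hd ⊢
          exact hle d c hd.le
        · have := hsub (show c ∈ _ by simp)
          simp at this
    · rintro ⟨h1, h2⟩
      by_contra hne
      rcases lt_or_gt_of_ne hne with hlt' | hgt
      · refine absurd h1 (not_le.2 (Finset.card_lt_card ⟨fun d hd => ?_, fun hsub => ?_⟩))
        · simp only [Finset.mem_filter, Finset.mem_univ, true_and] at hd ⊢
          exact (hle d c hd.le).trans_lt hlt'
        · have := hsub (show c ∈ _ by simpa using hlt')
          simp at this
      · have : h a + z a ≤ (Finset.univ.filter fun d => f d < f c).card := by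
          rw [hhz]
          refine Finset.card_le_card fun d hd => ?_
          simp only [Finset.mem_filter, Finset.mem_univ, true_and] at hd ⊢
          exact hlt d c (lt_of_le_of_lt hd hgt)
        omega
  have hlast : ∀ a, h a + (z a - 1) < θ.card := by
    intro a
    have h1 : h a + z a ≤ θ.card := by
      rw [hhz]
      exact (Finset.card_filter_le _ _).trans_eq (by simp)
    have := hz0 a
    omega
  have hpos : ∀ a, ∀ t ∈ Finset.Icc (h a) (h a + (z a - 1)), ∃ c, (f c : ℕ) = t ∧ N c = a := by
    intro a t ht
    rw [Finset.mem_Icc] at ht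
    have h1 : t < θ.card := ht.2.trans_lt (hlast a)
    refine ⟨f.symm ⟨t, h1⟩, by simp, (key a _).2 ?_⟩
    simpa using ht
  refine ⟨f, ⟨fun c d hcd => ?_, fun c d hcd => ?_⟩, h, fun a => z a - 1, ?_, ?_, ?_, ?_, ?_⟩
  · constructor
    · intro hfc
      by_contra hn
      rcases (not_lt.1 hn).eq_or_lt with heq | hlt'
      · rw [Subtype.ext (Prod.ext hcd heq.symm) (a1 := c) (a2 := d)] at hfc
        exact lt_irrefl _ hfc
      · rcases (hrow d c hcd.symm hlt').lt_or_eq with h1 | h1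
        · exact lt_asymm hfc (hlt d c h1)
        · exact lt_asymm hfc ((hf d c).2 (Or.inr ⟨h1, hlt'⟩))
    · intro h2
      rcases (hrow c d hcd h2).lt_or_eq with h1 | h1
      · exact hlt c d h1
      · exact (hf c d).2 (Or.inr ⟨h1, h2⟩)
  · constructor
    · intro hfc
      by_contra hn
      rcases (not_lt.1 hn).eq_or_lt with heq | hlt'
      · rw [Subtype.ext (Prod.ext heq.symm hcd) (a1 := c) (a2 := d)] at hfc
        exact lt_irrefl _ hfc
      · exact lt_asymm hfc (hlt d c (hcol d c hcd.symm hlt'))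
    · intro h2
      exact hlt c d (hcol c d hcd h2)
  · intro a b hab
    refine Finset.card_lt_card ⟨fun d hd => ?_, fun hsub => ?_⟩
    · simp only [Finset.mem_filter, Finset.mem_univ, true_and] at hd ⊢
      exact hd.trans hab
    · obtain ⟨c, hc⟩ := hN a
      have := hsub (show c ∈ _ by simpa [hc] using hab)
      simp [hc] at this
  · intro a c
    rw [hw, key]
  · rintro a ⟨c, hc, d, hd, h1, h2⟩
    rw [hw] at hc hd
    exact h1 (congrArg (fun x : θ => x.1.1) (hcol' c d (hc.trans hd.symm) h2))
  · intro a b hab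
    rw [Finset.disjoint_left]
    intro t ht ht'
    obtain ⟨c, hc, hca⟩ := hpos a t ht
    obtain ⟨d, hd, hdb⟩ := hpos b t ht'
    have hcd : c = d := f.injective (Fin.ext (hc.trans hd.symm))
    exact hab (by rw [← hca, hcd, hdb])
  · ext t
    simp only [Finset.mem_biUnion, Finset.mem_univ, true_and, Finset.mem_range]
    constructor
    · rintro ⟨a, ha⟩
      exact (Finset.mem_Icc.1 ha).2.trans_lt (hlast a)
    · intro ht
      refine ⟨N (f.symm ⟨t, ht⟩), Finset.mem_Icc.2 ?_⟩
      simpa using (key _ (f.symm ⟨t, ht⟩)).1 rfl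

/-! ### Signed sums over ordered set partitions -/

section OrderedPartition

variable {α : Type*}

/-- `w` is an ordered partition of `A` into nonempty blocks such that `L c d` holds if the block of
`c` precedes that of `d`, and `Q c d` holds if `c` and `d` lie in the same block. -/
def IsOrderedPartition (L Q : α → α → Prop) (A : Finset α) {m : ℕ} (w : Fin m → Finset α) : Prop :=
  (∀ c, c ∈ A ↔ ∃ a, c ∈ w a) ∧ (∀ a, (w a).Nonempty) ∧
    (∀ a b, a < b → ∀ c ∈ w a, ∀ d ∈ w b, c ≠ d ∧ L c d) ∧ ∀ a, ∀ c ∈ w a, ∀ d ∈ w a, Q c d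

theorem isOrderedPartition_zero_iff {L Q : α → α → Prop} {A : Finset α} {w : Fin 0 → Finset α} :
    IsOrderedPartition L Q A w ↔ A = ∅ := by
  constructor
  · intro h
    refine Finset.eq_empty_of_forall_notMem fun c hc => ?_
    obtain ⟨a, -⟩ := (h.1 c).1 hc
    exact a.elim0
  · rintro rfl
    exact ⟨fun c => by simp, fun a => a.elim0, fun a => a.elim0, fun a => a.elim0⟩

variable [DecidableEq α]

/-- `B` can be the first block of an ordered partition of `A`, or is empty. -/
def IsFirstBlock (L Q : α → α → Prop) (A B : Finset α) : Prop :=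
  B ⊆ A ∧ (∀ c ∈ B, ∀ d ∈ A \ B, L c d) ∧ ∀ c ∈ B, ∀ d ∈ B, Q c d

theorem isOrderedPartition_cons_iff {L Q : α → α → Prop} {A B : Finset α} {m : ℕ}
    {w : Fin m → Finset α} :
    IsOrderedPartition L Q A (Fin.cons B w : Fin (m + 1) → Finset α) ↔
      (IsFirstBlock L Q A B ∧ B.Nonempty) ∧ IsOrderedPartition L Q (A \ B) w := by
  constructor
  · rintro ⟨h1, h2, h3, h4⟩
    have hBA : B ⊆ A := fun c hc => (h1 c).2 ⟨0, hc⟩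
    have hmem : ∀ c, c ∈ A \ B ↔ ∃ a, c ∈ w a := by
      intro c
      rw [Finset.mem_sdiff, h1]
      constructor
      · rintro ⟨⟨a, ha⟩, hB⟩
        rcases Fin.eq_zero_or_eq_succ a with rfl | ⟨a, rfl⟩
        · exact absurd ha hB
        · exact ⟨a, ha⟩
      · rintro ⟨a, ha⟩
        exact ⟨⟨a.succ, ha⟩, fun hB => (h3 0 a.succ (Fin.succ_pos a) c hB c ha).1 rfl⟩
    refine ⟨⟨⟨hBA, fun c hc d hd => ?_, fun c hc d hd => h4 0 c hc d hd⟩, h2 0⟩, hmem,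
      fun a => h2 a.succ, fun a b hab => h3 a.succ b.succ (Fin.succ_lt_succ_iff.2 hab),
      fun a => h4 a.succ⟩
    obtain ⟨a, ha⟩ := (hmem d).1 hd
    exact (h3 0 a.succ (Fin.succ_pos a) c hc d ha).2
  · rintro ⟨⟨⟨hBA, hL, hQ⟩, hne⟩, h1, h2, h3, h4⟩
    refine ⟨fun c => ?_, fun a => ?_, fun a b hab => ?_, fun a => ?_⟩
    · rw [Fin.exists_fin_succ]
      simp only [Fin.cons_zero, Fin.cons_succ, ← h1, Finset.mem_sdiff]
      have := @hBA c
      tauto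
    · rcases Fin.eq_zero_or_eq_succ a with rfl | ⟨a, rfl⟩
      · exact hne
      · exact h2 a
    · obtain ⟨b, rfl⟩ := Fin.exists_succ_eq.2 (Fin.ne_zero_of_lt hab)
      intro c hc d hd
      rw [Fin.cons_succ] at hd
      rcases Fin.eq_zero_or_eq_succ a with rfl | ⟨a, rfl⟩
      · have hd' := (h1 d).2 ⟨b, hd⟩
        rw [Fin.cons_zero] at hc
        exact ⟨fun h => (Finset.mem_sdiff.1 hd').2 (h ▸ hc), hL c hc d hd'⟩
      · exact h3 a b (Fin.succ_lt_succ_iff.1 hab) c hc d hd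
    · rcases Fin.eq_zero_or_eq_succ a with rfl | ⟨a, rfl⟩
      · exact hQ
      · exact h4 a

open Classical in
/-- A sum over ordered partitions is determined by its recursion with respect to the first block. -/
theorem sum_isOrderedPartition [Fintype α] {L Q : α → α → Prop} {x : ℂ} {V : Finset α → ℂ}
    (h0 : V ∅ = 1)
    (hV : ∀ A : Finset α, A.Nonempty →
      V A = x * ∑ B : Finset α with IsFirstBlock L Q A B ∧ B.Nonempty, V (A \ B)) (M : ℕ) :
    ∀ A : Finset α, A.card < M → ∑ m ∈ Finset.range M,
      ∑ w : Fin m → Finset α with IsOrderedPartition L Q A w, x ^ m = V A := by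
  induction M with
  | zero => intro A hA; exact absurd hA (Nat.not_lt_zero _)
  | succ M ih =>
    intro A hA
    have hstep : ∀ m : ℕ, ∑ w : Fin (m + 1) → Finset α with IsOrderedPartition L Q A w, x ^ (m + 1) =
        x * ∑ B : Finset α with IsFirstBlock L Q A B ∧ B.Nonempty,
          ∑ w : Fin m → Finset α with IsOrderedPartition L Q (A \ B) w, x ^ m := by
      intro m
      simp only [Finset.sum_filter]
      rw [← (Fin.consEquiv fun _ : Fin (m + 1) => Finset α).sum_comp, Fintype.sum_prod_type,
        Finset.mul_sum]
      refine Finset.sum_congr rfl fun B _ => ?_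
      simp only [Fin.consEquiv, Equiv.coe_fn_mk, isOrderedPartition_cons_iff]
      by_cases hB : IsFirstBlock L Q A B ∧ B.Nonempty
      · simp only [hB, true_and, if_true, Finset.mul_sum, and_self]
        refine Finset.sum_congr rfl fun w _ => ?_
        split_ifs
        · exact pow_succ' x m
        · simp
      · simp only [hB, false_and, if_false, Finset.sum_const_zero, mul_zero]
    rw [Finset.sum_range_succ', Finset.sum_congr rfl fun m _ => hstep m, ← Finset.mul_sum,
      Finset.sum_comm]
    rcases A.eq_empty_or_nonempty with rfl | hne
    · rw [Finset.sum_eq_zero (s := Finset.univ.filter _), h0, mul_zero, zero_add]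
      · simp [isOrderedPartition_zero_iff]
      · intro B hB
        obtain ⟨⟨hB1, -⟩, hB2⟩ := (Finset.mem_filter.1 hB).2
        exact absurd hB1 (by rw [Finset.subset_empty]; exact hB2.ne_empty)
    · rw [hV A hne, Finset.sum_eq_zero (s := Finset.univ.filter _) (f := fun w => x ^ 0), add_zero]
      · congr 1
        refine Finset.sum_congr rfl fun B hB => ih _ ?_
        obtain ⟨⟨hB1, -⟩, hB2⟩ := (Finset.mem_filter.1 hB).2
        have h1 := Finset.card_sdiff_add_card_eq_card hB1
        have h2 := hB2.card_pos
        omega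
      · intro w hw
        exact absurd (isOrderedPartition_zero_iff.1 (Finset.mem_filter.1 hw).2) hne.ne_empty

end OrderedPartition

/-! ### Counting the ordered partitions compatible with a filling -/

variable {θ : Finset (ℕ × ℕ)}

/-- The condition on a box `c` in an earlier block than the box `d`. -/
def Before (e : ℕ) (g : θ → ℕ+) (c d : θ) : Prop :=
  ¬ (c.1.1 = d.1.1 ∧ d.1.2 < c.1.2) ∧ ¬ (c.1.2 = d.1.2 ∧ d.1.1 < c.1.1) ∧ (g c : ℕ) + e ≤ g d

/-- The condition on two boxes in the same block. -/
def Together (g : θ → ℕ+) (c d : θ) : Prop :=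
  g c = g d ∧ ¬ (c.1.2 = d.1.2 ∧ c.1.1 < d.1.1)

/-- `g` is constant on each block of `w`, and its values form a chain. -/
def Compatible (e : ℕ) {m : ℕ} (w : Fin m → Finset θ) (g : θ → ℕ+) : Prop :=
  ∃ n : Fin m → ℕ+, Chain e n ∧ ∀ a, ∀ c ∈ w a, g c = n a

/-- Rows weakly increasing and columns strictly increasing on `A`. -/
def RowWeakColStrict (g : θ → ℕ+) (A : Finset θ) : Prop :=
  ∀ c ∈ A, ∀ d ∈ A, (c.1.1 = d.1.1 → c.1.2 < d.1.2 → g c ≤ g d) ∧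
    (c.1.2 = d.1.2 → c.1.1 < d.1.1 → g c < g d)

/-- Rows strictly increasing and columns weakly increasing on `A`. -/
def RowStrictColWeak (g : θ → ℕ+) (A : Finset θ) : Prop :=
  ∀ c ∈ A, ∀ d ∈ A, (c.1.1 = d.1.1 → c.1.2 < d.1.2 → g c < g d) ∧
    (c.1.2 = d.1.2 → c.1.1 < d.1.1 → g c ≤ g d)

/-- For fixed `g` all conditions become pairwise conditions on boxes in different blocks or in the
same block, the form that the recursion over first blocks requires. -/
theorem preceq_and_compatible_iff {e m : ℕ} {w : Fin m → Finset θ} {g : θ → ℕ+} :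
    Preceq θ m w ∧ Compatible e w g ↔
      IsOrderedPartition (Before e g) (Together g) Finset.univ w := by
  constructor
  · rintro ⟨hp, n, hn, hg⟩
    obtain ⟨N, hN, hrow, hcol, hw⟩ := hp.exists_blockIndex
    refine ⟨fun c => ⟨fun _ => ⟨N c, (hw _ _).2 rfl⟩, fun _ => Finset.mem_univ c⟩, fun a => ?_,
      fun a b hab c hc d hd => ?_, fun a c hc d hd => ?_⟩
    · obtain ⟨c, hc⟩ := hN a
      exact ⟨c, (hw a c).2 hc⟩
    · have hgc := hg a c hc
      have hgd := hg b d hd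
      rw [hw] at hc hd
      subst hc hd
      refine ⟨fun h => hab.ne (by rw [h]), fun h => ?_, fun h => ?_, ?_⟩
      · exact absurd (hrow d c h.1.symm h.2) (not_le.2 hab)
      · exact absurd (hcol d c h.1.symm h.2) (not_lt.2 hab.le)
      · rw [hgc, hgd]; exact hn _ _ hab
    · refine ⟨(hg a c hc).trans (hg a d hd).symm, fun h => ?_⟩
      rw [hw] at hc hd
      exact (hcol c d h.1 h.2).ne (hc.trans hd.symm)
  · rintro ⟨h1, h2, h3, h4⟩
    choose N hN using fun c => (h1 c).1 (Finset.mem_univ c)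
    have hw : ∀ a c, c ∈ w a ↔ N c = a := by
      refine fun a c => ⟨fun hc => ?_, fun h => h ▸ hN c⟩
      rcases lt_trichotomy (N c) a with h | h | h
      · exact absurd rfl (h3 _ _ h c (hN c) c hc).1
      · exact h
      · exact absurd rfl (h3 _ _ h c hc c (hN c)).1
    choose b hb using h2
    refine ⟨preceq_of_blockIndex (N := N) (fun a => ⟨b a, (hw _ _).1 (hb a)⟩) (fun c d hcd hlt => ?_)
      (fun c d hcd hlt => ?_) hw, fun a => g (b a), fun i j hij => ?_, fun a c hc => ?_⟩
    · by_contra h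
      exact (h3 _ _ (not_le.1 h) d (hN d) c (hN c)).2.1 ⟨hcd.symm, hlt⟩
    · rcases lt_trichotomy (N c) (N d) with h | h | h
      · exact h
      · exact absurd ⟨hcd, hlt⟩ (h4 _ c (hN c) d (h ▸ hN d)).2
      · exact absurd ⟨hcd.symm, hlt⟩ (h3 _ _ h d (hN d) c (hN c)).2.2.1
    · exact (h3 i j hij _ (hb i) _ (hb j)).2.2.2
    · exact (h4 a c hc _ (hb a)).1

open Classical in
-- Strictly increasing block values force the first block to be the full set `B₀` of boxes at which
-- `g` is minimal. Hence at most one partition, by level sets, is compatible, and the semistandard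
-- condition splits along `B₀` accordingly.
theorem sum_compatible_one (g : θ → ℕ+) :
    ∑ m ∈ Finset.range (θ.card + 1), ∑ w : Fin m → Finset θ with Preceq θ m w ∧ Compatible 1 w g,
      (1 : ℂ) = if RowWeakColStrict g Finset.univ then 1 else 0 := by
  have h := sum_isOrderedPartition (L := Before 1 g) (Q := Together g) (x := 1)
    (V := fun A => if RowWeakColStrict g A then 1 else 0) (by simp [RowWeakColStrict]) ?_
    (θ.card + 1) Finset.univ (by simp)
  · simp only [one_pow] at h
    simp only [preceq_and_compatible_iff]
    convert h
  intro A hA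
  set B₀ := A.filter fun c => ∀ d ∈ A, g c ≤ g d with hB₀
  have hmem : ∀ c, c ∈ B₀ ↔ c ∈ A ∧ ∀ d ∈ A, g c ≤ g d := fun c => Finset.mem_filter
  obtain ⟨x, hxA, hx⟩ := A.exists_min_image g hA
  have hfirst : ∀ B, IsFirstBlock (Before 1 g) (Together g) A B ∧ B.Nonempty → B = B₀ := by
    rintro B ⟨⟨hBA, hL, hQ⟩, b, hb⟩
    have hBmin : ∀ c ∈ B, ∀ d ∈ A, g c ≤ g d := by
      intro c hc d hd
      by_cases hdB : d ∈ B
      · exact (hQ c hc d hdB).1.le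
      · have := (hL c hc d (Finset.mem_sdiff.2 ⟨hd, hdB⟩)).2.2
        have h2 : (g c : ℕ) ≤ g d := by omega
        exact_mod_cast h2
    ext c
    rw [hmem]
    refine ⟨fun hc => ⟨hBA hc, hBmin c hc⟩, fun hc => ?_⟩
    by_contra hcB
    have h1 := (hL b hb c (Finset.mem_sdiff.2 ⟨hc.1, hcB⟩)).2.2
    have h2 : (g c : ℕ) ≤ g b := by exact_mod_cast hc.2 b (hBA hb)
    omega
  have hB₀ne : B₀.Nonempty := ⟨x, (hmem x).2 ⟨hxA, hx⟩⟩
  have hiff : RowWeakColStrict g A ↔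
      IsFirstBlock (Before 1 g) (Together g) A B₀ ∧ RowWeakColStrict g (A \ B₀) := by
    have hlt : ∀ c ∈ B₀, ∀ d ∈ A \ B₀, g c < g d := by
      intro c hc d hd
      rw [Finset.mem_sdiff, hmem] at hd
      rw [hmem] at hc
      refine (hc.2 d hd.1).lt_of_ne fun h => hd.2 ⟨hd.1, fun u hu => h ▸ hc.2 u hu⟩
    constructor
    · intro hg
      refine ⟨⟨Finset.filter_subset _ _, fun c hc d hd => ?_, fun c hc d hd => ?_⟩,
        fun c hc d hd => hg c (Finset.mem_sdiff.1 hc).1 d (Finset.mem_sdiff.1 hd).1⟩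
      · have h1 := hlt c hc d hd
        have hcA := ((hmem c).1 hc).1
        have hdA := (Finset.mem_sdiff.1 hd).1
        exact ⟨fun h => absurd ((hg d hdA c hcA).1 h.1.symm h.2) (not_le.2 h1),
          fun h => absurd ((hg d hdA c hcA).2 h.1.symm h.2) (not_lt.2 h1.le), by
            exact_mod_cast h1⟩
      · rw [hmem] at hc hd
        have h1 : g c = g d := le_antisymm (hc.2 d hd.1) (hd.2 c hc.1)
        exact ⟨h1, fun h => absurd h1 ((hg c hc.1 d hd.1).2 h.1 h.2).ne⟩
    · rintro ⟨⟨-, hL, hQ⟩, hg⟩ c hc d hd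
      by_cases hcB : c ∈ B₀ <;> by_cases hdB : d ∈ B₀
      · have := hQ c hcB d hdB
        exact ⟨fun _ _ => this.1.le, fun h1 h2 => absurd ⟨h1, h2⟩ this.2⟩
      · have h1 := hlt c hcB d (Finset.mem_sdiff.2 ⟨hd, hdB⟩)
        exact ⟨fun _ _ => h1.le, fun _ _ => h1⟩
      · have := hL d hdB c (Finset.mem_sdiff.2 ⟨hc, hcB⟩)
        exact ⟨fun h1 h2 => absurd ⟨h1.symm, h2⟩ this.1, fun h1 h2 => absurd ⟨h1.symm, h2⟩ this.2.1⟩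
      · exact hg c (Finset.mem_sdiff.2 ⟨hc, hcB⟩) d (Finset.mem_sdiff.2 ⟨hd, hdB⟩)
  rw [one_mul]
  by_cases hF : IsFirstBlock (Before 1 g) (Together g) A B₀
  · have : (Finset.univ.filter fun B => IsFirstBlock (Before 1 g) (Together g) A B ∧ B.Nonempty) =
        {B₀} := by
      ext B
      simp only [Finset.mem_filter, Finset.mem_univ, true_and, Finset.mem_singleton]
      exact ⟨hfirst B, fun h => h ▸ ⟨hF, hB₀ne⟩⟩
    rw [this, Finset.sum_singleton]
    simp only [hiff, hF, true_and]
  · have : (Finset.univ.filter fun B => IsFirstBlock (Before 1 g) (Together g) A B ∧ B.Nonempty) =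
        ∅ := by
      ext B
      simp only [Finset.mem_filter, Finset.mem_univ, true_and, Finset.notMem_empty, iff_false]
      exact fun h => hF (hfirst B h ▸ h.1)
    rw [this, Finset.sum_empty, if_neg fun h => hF (hiff.1 h).1]

/-- The box `x` has minimal value and, among those boxes, lies in the rightmost column and is
topmost in it. Boxes of equal value in its row are then to its left and those in its column below
it, so moving `x` between the first block and the rest violates no condition. -/
theorem rowStrictColWeak_sdiff_insert_iff {g : θ → ℕ+} {A : Finset θ} {x : θ}
    [DecidableEq θ] (hxA : x ∈ A)
    (hx : ∀ d ∈ A, g x < g d ∨ g x = g d ∧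
      (d.1.2 < x.1.2 ∨ d.1.2 = x.1.2 ∧ x.1.1 ≤ d.1.1)) {B : Finset θ} (hxB : x ∉ B) :
    (IsFirstBlock (Before 0 g) (Together g) A B ∧ RowStrictColWeak g (A \ B)) ↔
      (IsFirstBlock (Before 0 g) (Together g) A (insert x B) ∧
        RowStrictColWeak g (A \ insert x B)) := by
  have hmin : ∀ d ∈ A, g x ≤ g d := fun d hd => (hx d hd).elim le_of_lt fun h => h.1.le
  constructor
  · rintro ⟨⟨hBA, hL, hQ⟩, hg⟩
    have hval : ∀ c ∈ B, g c = g x := by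
      intro c hc
      refine le_antisymm ?_ (hmin c (hBA hc))
      have := (hL c hc x (Finset.mem_sdiff.2 ⟨hxA, hxB⟩)).2.2
      exact_mod_cast this
    refine ⟨⟨Finset.insert_subset hxA hBA, fun c hc d hd => ?_, fun c hc d hd => ?_⟩,
      fun c hc d hd => ?_⟩
    · rw [Finset.mem_sdiff, Finset.mem_insert, not_or] at hd
      have hdAB : d ∈ A \ B := Finset.mem_sdiff.2 ⟨hd.1, hd.2.2⟩
      rcases Finset.mem_insert.1 hc with rfl | hcB
      · have hpair := hg d hdAB c (Finset.mem_sdiff.2 ⟨hxA, hxB⟩)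
        refine ⟨fun h => ?_, fun h => ?_, ?_⟩
        · exact absurd (hpair.1 h.1.symm h.2) (not_lt.2 (hmin d hd.1))
        · have h1 := le_antisymm (hpair.2 h.1.symm h.2) (hmin d hd.1)
          rcases hx d hd.1 with h2 | ⟨-, h2⟩
          · exact h2.ne h1.symm
          · omega
        · exact_mod_cast hmin d hd.1
      · exact hL c hcB d hdAB
    · rcases Finset.mem_insert.1 hc with rfl | hcB <;> rcases Finset.mem_insert.1 hd with rfl | hdB
      · exact ⟨rfl, fun h => h.2.false⟩
      · refine ⟨(hval d hdB).symm, fun h => ?_⟩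
        exact (hL d hdB c (Finset.mem_sdiff.2 ⟨hxA, hxB⟩)).2.1 ⟨h.1.symm, h.2⟩
      · refine ⟨hval c hcB, fun h => ?_⟩
        rcases hx c (hBA hcB) with h2 | ⟨-, h2⟩
        · exact h2.ne (hval c hcB).symm
        · omega
      · exact hQ c hcB d hdB
    · rw [Finset.mem_sdiff, Finset.mem_insert, not_or] at hc hd
      exact hg c (Finset.mem_sdiff.2 ⟨hc.1, hc.2.2⟩) d (Finset.mem_sdiff.2 ⟨hd.1, hd.2.2⟩)
  · rintro ⟨⟨hBA, hL, hQ⟩, hg⟩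
    have hxi : x ∈ insert x B := Finset.mem_insert_self x B
    have hval : ∀ c ∈ B, g c = g x := fun c hc => (hQ c (Finset.mem_insert_of_mem hc) x hxi).1
    refine ⟨⟨(Finset.subset_insert x B).trans hBA, fun c hc d hd => ?_, fun c hc d hd =>
      hQ c (Finset.mem_insert_of_mem hc) d (Finset.mem_insert_of_mem hd)⟩, fun c hc d hd => ?_⟩
    · rw [Finset.mem_sdiff] at hd
      by_cases hdx : d = x
      · subst hdx
        refine ⟨fun h => ?_, fun h => ?_, by rw [hval c hc]; rfl⟩
        · rcases hx c (hBA (Finset.mem_insert_of_mem hc)) with h2 | ⟨-, h2⟩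
          · exact h2.ne (hval c hc).symm
          · omega
        · exact (hQ d hxi c (Finset.mem_insert_of_mem hc)).2 ⟨h.1.symm, h.2⟩
      · exact hL c (Finset.mem_insert_of_mem hc) d (Finset.mem_sdiff.2
          ⟨hd.1, fun h => (Finset.mem_insert.1 h).elim hdx hd.2⟩)
    · rw [Finset.mem_sdiff] at hc hd
      by_cases hcx : c = x <;> by_cases hdx : d = x
      · subst hcx hdx
        exact ⟨fun _ h => absurd h (lt_irrefl _), fun _ h => absurd h (lt_irrefl _)⟩
      · subst hcx
        refine ⟨fun h1 h2 => ?_, fun _ _ => hmin d hd.1⟩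
        rcases hx d hd.1 with h3 | ⟨-, h3⟩
        · exact h3
        · omega
      · subst hdx
        have := hL d hxi c (Finset.mem_sdiff.2
          ⟨hc.1, fun h => (Finset.mem_insert.1 h).elim hcx hc.2⟩)
        exact ⟨fun h1 h2 => absurd ⟨h1.symm, h2⟩ this.1, fun h1 h2 => absurd ⟨h1.symm, h2⟩ this.2.1⟩
      · exact hg c (Finset.mem_sdiff.2 ⟨hc.1, fun h => (Finset.mem_insert.1 h).elim hcx hc.2⟩)
          d (Finset.mem_sdiff.2 ⟨hd.1, fun h => (Finset.mem_insert.1 h).elim hdx hd.2⟩)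

open Classical in
-- Inserting or removing the extremal box `x` is an involution on the admissible blocks, the empty
-- one included, that changes the parity of `B.card`.
theorem sum_isFirstBlock_eq_zero (g : θ → ℕ+) {A : Finset θ} (hA : A.Nonempty) :
    ∑ B : Finset θ with IsFirstBlock (Before 0 g) (Together g) A B,
      (-1 : ℂ) ^ B.card * (if RowStrictColWeak g (A \ B) then 1 else 0) = 0 := by
  obtain ⟨x, hxA, hx'⟩ := A.exists_min_image
    (fun c : θ => toLex (g c, toLex (-(c.1.2 : ℤ), (c.1.1 : ℤ)))) hA
  have hx : ∀ d ∈ A, g x < g d ∨ g x = g d ∧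
      (d.1.2 < x.1.2 ∨ d.1.2 = x.1.2 ∧ x.1.1 ≤ d.1.1) := by
    intro d hd
    have := hx' d hd
    simp only [Prod.Lex.toLex_le_toLex] at this
    exact this.imp id fun h => ⟨h.1, by omega⟩
  have key : ∀ B, x ∉ B → _ := fun B => rowStrictColWeak_sdiff_insert_iff hxA hx (B := B)
  simp only [← Finset.sum_filter, mul_ite, mul_one, mul_zero, Finset.filter_filter]
  have htoggle : ∀ B : Finset θ, (IsFirstBlock (Before 0 g) (Together g) A B ∧
      RowStrictColWeak g (A \ B)) ↔ (IsFirstBlock (Before 0 g) (Together g) A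
        (if x ∈ B then B.erase x else insert x B) ∧
        RowStrictColWeak g (A \ (if x ∈ B then B.erase x else insert x B))) := by
    intro B
    split_ifs with h
    · rw [key (B.erase x) (Finset.notMem_erase x B), Finset.insert_erase h]
    · exact key B h
  refine Finset.sum_involution (fun B _ => if x ∈ B then B.erase x else insert x B) ?_ ?_ ?_ ?_
  · intro B _
    split_ifs with h
    · have h1 := Finset.card_erase_add_one h
      rw [← h1, pow_succ]; ring
    · rw [Finset.card_insert_of_notMem h, pow_succ]; ring
  · intro B _ _ heq
    split_ifs at heq with h
    · exact Finset.notMem_erase x B (heq.symm ▸ h)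
    · exact h (heq ▸ Finset.mem_insert_self x B)
  · intro B hB
    rw [Finset.mem_filter] at hB ⊢
    exact ⟨Finset.mem_univ _, (htoggle B).1 hB.2⟩
  · intro B _
    by_cases h : x ∈ B
    · simp [h]
    · simp [h]

open Classical in
theorem sum_compatible_zero (g : θ → ℕ+) :
    ∑ m ∈ Finset.range (θ.card + 1), ∑ w : Fin m → Finset θ with Preceq θ m w ∧ Compatible 0 w g,
      (-1 : ℂ) ^ (θ.card - m) = if RowStrictColWeak g Finset.univ then 1 else 0 := by
  have hsq : ∀ n : ℕ, (-1 : ℂ) ^ n * (-1) ^ n = 1 := fun n => by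
    rw [← mul_pow]; simp
  have h := sum_isOrderedPartition (L := Before 0 g) (Q := Together g) (x := -1)
    (V := fun A => (-1 : ℂ) ^ A.card * if RowStrictColWeak g A then 1 else 0)
    (by simp [RowStrictColWeak]) ?_ (θ.card + 1) Finset.univ (by simp)
  · have h2 := congrArg (fun z => (-1 : ℂ) ^ θ.card * z) h
    simp only [Finset.card_univ, Fintype.card_coe, ← mul_assoc, hsq, one_mul, Finset.mul_sum] at h2
    simp only [preceq_and_compatible_iff]
    refine Eq.trans ?_ h2
    refine Finset.sum_congr rfl fun m hm => ?_
    have hm' : m ≤ θ.card := Nat.lt_succ_iff.1 (Finset.mem_range.1 hm)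
    have h3 : (-1 : ℂ) ^ (θ.card - m) = (-1) ^ θ.card * (-1) ^ m := by
      conv_rhs => rw [← Nat.sub_add_cancel hm', pow_add, mul_assoc, hsq, mul_one]
    rw [h3]
  intro A hA
  have hz := sum_isFirstBlock_eq_zero g hA
  have hempty : IsFirstBlock (Before 0 g) (Together g) A ∅ :=
    ⟨Finset.empty_subset A, by simp, by simp⟩
  have hins : (Finset.univ.filter fun B => IsFirstBlock (Before 0 g) (Together g) A B) =
      insert ∅ (Finset.univ.filter fun B =>
        IsFirstBlock (Before 0 g) (Together g) A B ∧ B.Nonempty) := by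
    ext B
    simp only [Finset.mem_filter, Finset.mem_univ, true_and, Finset.mem_insert]
    constructor
    · intro hB
      rcases B.eq_empty_or_nonempty with h | h
      · exact Or.inl h
      · exact Or.inr ⟨hB, h⟩
    · rintro (rfl | h)
      · exact hempty
      · exact h.1
  -- Isolating the empty block in the vanishing sum gives the first-block recursion with weight
  -- `-1`.
  rw [hins, Finset.sum_insert (by simp), Finset.card_empty, pow_zero, one_mul,
    Finset.sdiff_empty] at hz
  rw [eq_neg_of_add_eq_zero_left hz, neg_one_mul, mul_neg, Finset.mul_sum]
  congr 1
  refine Finset.sum_congr rfl fun B hB => ?_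
  have h1 := Finset.card_sdiff_add_card_eq_card (Finset.mem_filter.1 hB).2.1.1
  rw [← h1, pow_add, ← mul_assoc, mul_assoc (_ ^ (A \ B).card), hsq, mul_one]

/-! ### Sums over fillings of a diagram -/

/-- The term `∏ g(c)^{-s(c)}` of a filling `g`. -/
noncomputable def fillTerm {ι : Type*} [Fintype ι] (s : ι → ℂ) (g : ι → ℕ+) : ℂ :=
  ∏ c, ((g c : ℕ) : ℂ) ^ (-s c)

theorem summable_norm_fillTerm {ι : Type*} [Fintype ι] {s : ι → ℂ} (hs : ∀ c, 2 < (s c).re) :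
    Summable fun g : ι → ℕ+ => ‖fillTerm s g‖ := by
  refine Summable.of_nonneg_of_le (fun _ => norm_nonneg _) (fun g => ?_)
    (summable_prod_rpow_neg ι one_lt_two)
  rw [fillTerm, norm_prod]
  refine Finset.prod_le_prod (fun _ _ => norm_nonneg _) fun c _ => ?_
  rw [norm_pnat_cpow]
  refine pnat_rpow_le _ ?_
  rw [Complex.neg_re]
  linarith [hs c]

open Classical in
theorem summable_ite_fillTerm {ι : Type*} [Fintype ι] {s : ι → ℂ} (hs : ∀ c, 2 < (s c).re)
    (P : (ι → ℕ+) → Prop) : Summable fun g : ι → ℕ+ => if P g then fillTerm s g else 0 := by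
  refine ((summable_norm_fillTerm hs).of_norm.indicator {g | P g}).congr fun g => ?_
  by_cases h : P g <;> simp [Set.indicator, h]

theorem blockSums_mem_convDomain {m : ℕ} {w : Fin m → Finset θ} (hw : Preceq θ m w) {s : θ → ℂ}
    (hs : ∀ c, 2 < (s c).re) : blockSums s w ∈ convDomain m := by
  refine mem_convDomain_of_one_lt fun a => ?_
  obtain ⟨N, hN, -, -, hmem⟩ := hw.exists_blockIndex
  obtain ⟨c, hc⟩ := hN a
  have hca : c ∈ w a := (hmem a c).2 hc
  rw [blockSums, Complex.re_sum]
  have h1 : (s c).re ≤ ∑ d ∈ w a, (s d).re :=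
    Finset.single_le_sum (f := fun d => (s d).re) (fun d _ => by linarith [hs d]) hca
  linarith [hs c]

open Classical in
-- Composition with the block index turns tuples of block values into the fillings constant on
-- blocks, and a block sum in the exponent becomes a product over the boxes of the block.
theorem chainSeries_blockSums (e : ℕ) {m : ℕ} {w : Fin m → Finset θ} (hw : Preceq θ m w)
    (s : θ → ℂ) : chainSeries e m (blockSums s w) =
      ∑' g : θ → ℕ+, if Compatible e w g then fillTerm s g else 0 := by
  obtain ⟨N, hN, -, -, hmem⟩ := hw.exists_blockIndex
  have hinj : Function.Injective fun n : Fin m → ℕ+ => n ∘ N := fun n n' h => by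
    funext a
    obtain ⟨c, rfl⟩ := hN a
    exact congrFun h c
  rw [← hinj.tsum_eq (f := fun g => if Compatible e w g then fillTerm s g else 0), chainSeries]
  · refine tsum_congr fun n => ?_
    have h1 : Compatible e w (n ∘ N) ↔ Chain e n := by
      constructor
      · rintro ⟨n', hn', h⟩
        have : n = n' := by
          funext a
          obtain ⟨c, rfl⟩ := hN a
          exact h _ c ((hmem _ c).2 rfl)
        exact this ▸ hn'
      · exact fun h => ⟨n, h, fun a c hc => by rw [Function.comp_apply, (hmem a c).1 hc]⟩
    have h2 : term (blockSums s w) n = fillTerm s (n ∘ N) := by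
      rw [term, fillTerm, ← Finset.prod_fiberwise Finset.univ N]
      refine Finset.prod_congr rfl fun a _ => ?_
      have h3 : w a = Finset.univ.filter fun c => N c = a := by
        ext c; simp [hmem]
      have hne : ((n a : ℕ) : ℂ) ≠ 0 := by exact_mod_cast (n a).ne_zero
      rw [blockSums, ← Finset.sum_neg_distrib, Complex.cpow_def_of_ne_zero hne, Finset.mul_sum,
        Complex.exp_sum, h3]
      refine Finset.prod_congr rfl fun c hc => ?_
      rw [Function.comp_apply, (Finset.mem_filter.1 hc).2, Complex.cpow_def_of_ne_zero hne]
    simp only [h1, h2]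
  · intro g hg
    have hc : Compatible e w g := by
      by_contra h
      exact hg (if_neg h)
    obtain ⟨n, -, h⟩ := hc
    exact ⟨n, funext fun c => (h _ c ((hmem _ c).2 rfl)).symm⟩

open Classical in
theorem sumPreceq_eq_tsum {e : ℕ} (he : e ≤ 1) {s : θ → ℂ} (hs : ∀ c, 2 < (s c).re) (x : ℕ → ℂ) :
    sumPreceq s (fun m t => x m * continuation (convDomain m) (chainSeries e m) t) =
      ∑' g : θ → ℕ+, fillTerm s g * ∑ m ∈ Finset.range (θ.card + 1),
        ∑ w : Fin m → Finset θ with Preceq θ m w ∧ Compatible e w g, x m := by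
  have hsum : ∀ (m : ℕ) (w : Fin m → Finset θ), Summable fun g : θ → ℕ+ =>
      x m * if Compatible e w g then fillTerm s g else 0 := fun m w =>
    (summable_ite_fillTerm hs _).mul_left _
  have hval : ∀ (m : ℕ) (w : Fin m → Finset θ), Preceq θ m w →
      x m * continuation (convDomain m) (chainSeries e m) (blockSums s w) =
        ∑' g : θ → ℕ+, x m * if Compatible e w g then fillTerm s g else 0 := by
    intro m w hw
    rw [(chain_continuation he m).1.2 (blockSums_mem_convDomain hw hs),
      chainSeries_blockSums e hw, tsum_mul_left]
  rw [sumPreceq]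
  calc _ = ∑ m ∈ Finset.range (θ.card + 1), ∑' g : θ → ℕ+,
        ∑ w : Fin m → Finset θ with Preceq θ m w,
          x m * if Compatible e w g then fillTerm s g else 0 := by
        refine Finset.sum_congr rfl fun m _ => ?_
        rw [Summable.tsum_finsetSum fun w _ => hsum m w]
        exact Finset.sum_congr rfl fun w hw => hval m w (Finset.mem_filter.1 hw).2
    _ = ∑' g : θ → ℕ+, ∑ m ∈ Finset.range (θ.card + 1),
        ∑ w : Fin m → Finset θ with Preceq θ m w,
          x m * if Compatible e w g then fillTerm s g else 0 :=
        (Summable.tsum_finsetSum fun m _ => summable_sum fun w _ => hsum m w).symm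
    _ = _ := by
        refine tsum_congr fun g => ?_
        rw [Finset.mul_sum]
        refine Finset.sum_congr rfl fun m _ => ?_
        rw [Finset.mul_sum, ← Finset.filter_filter, Finset.sum_filter (p := fun w => Compatible e w g)]
        refine Finset.sum_congr rfl fun w _ => ?_
        split_ifs <;> ring

open Classical in
theorem sumPreceq_zetaEZ {s : θ → ℂ} (hs : ∀ c, 2 < (s c).re) :
    sumPreceq s (fun m t => zetaEZ m t) =
      ∑' g : θ → ℕ+, if RowWeakColStrict g Finset.univ then fillTerm s g else 0 := by
  have h := sumPreceq_eq_tsum le_rfl hs fun _ => 1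
  simp only [one_mul, ← zetaEZ_eq, sum_compatible_one, mul_ite, mul_one, mul_zero] at h
  exact h

open Classical in
theorem sumPreceq_zetaEZStar {s : θ → ℂ} (hs : ∀ c, 2 < (s c).re) :
    sumPreceq s (fun m t => (-1) ^ (θ.card - m) * zetaEZStar m t) =
      ∑' g : θ → ℕ+, if RowStrictColWeak g Finset.univ then fillTerm s g else 0 := by
  have h := sumPreceq_eq_tsum zero_le_one hs fun m => (-1) ^ (θ.card - m)
  simp only [← zetaEZStar_eq, sum_compatible_zero, mul_ite, mul_one, mul_zero] at h
  exact h

open Classical in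
theorem tsum_rowStrictColWeak_transpose (s : θ → ℂ) :
    ∑' g : transposeDiagram θ → ℕ+,
        (if RowStrictColWeak g Finset.univ then fillTerm (transpose s) g else 0) =
      ∑' g : θ → ℕ+, if RowWeakColStrict g Finset.univ then fillTerm s g else 0 := by
  let τ : transposeDiagram θ ≃ θ :=
    { toFun := fun c => ⟨c.1.swap, by
        obtain ⟨d, hd, hdc⟩ := Finset.mem_map.1 c.2
        rw [← hdc]; simpa using hd⟩
      invFun := fun d => ⟨d.1.swap, Finset.mem_map.2 ⟨d.1, d.2, rfl⟩⟩
      left_inv := fun c => Subtype.ext (Prod.swap_swap _)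
      right_inv := fun d => Subtype.ext (Prod.swap_swap _) }
  rw [← (Equiv.arrowCongr τ.symm (Equiv.refl ℕ+)).tsum_eq]
  refine tsum_congr fun g => ?_
  have h1 : fillTerm (transpose s) (Equiv.arrowCongr τ.symm (Equiv.refl ℕ+) g) = fillTerm s g :=
    Fintype.prod_equiv τ _ _ fun c => rfl
  have h2 : RowStrictColWeak (Equiv.arrowCongr τ.symm (Equiv.refl ℕ+) g) Finset.univ ↔
      RowWeakColStrict g Finset.univ := by
    constructor
    · intro h c _ d _
      exact (h (τ.symm c) (Finset.mem_univ _) (τ.symm d) (Finset.mem_univ _)).symm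
    · intro h c _ d _
      exact (h (τ c) (Finset.mem_univ _) (τ d) (Finset.mem_univ _)).symm
  simp only [h1, h2]

/-! ### The anti-hook -/

theorem chain_iff_succ {e n : ℕ} {m : Fin n → ℕ+} :
    Chain e m ↔ ∀ j (h : j + 1 < n), (m ⟨j, by omega⟩ : ℕ) + e ≤ m ⟨j + 1, h⟩ := by
  constructor
  · exact fun h j hj => h _ _ (Fin.lt_def.2 (Nat.lt_succ_self j))
  · intro h i j hij
    obtain ⟨i, hi⟩ := i
    obtain ⟨j, hj⟩ := j
    have hij' : i + 1 ≤ j := hij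
    clear hij
    induction j, hij' using Nat.le_induction with
    | base => exact h i hj
    | succ j hij ih =>
      have h1 := ih (by omega)
      have h2 := h j hj
      omega

variable {k ℓ : ℕ}

/-- The boxes of the anti-hook, along the row from left to right and then up the column. -/
def box (k ℓ p : ℕ) : antiHook k ℓ :=
  ⟨(ℓ - (p - k), min p k), by simp [antiHook]; omega⟩

theorem exists_box (c : antiHook k ℓ) : ∃ p ≤ k + ℓ, c = box k ℓ p := by
  obtain ⟨⟨i, j⟩, hc⟩ := c
  simp only [antiHook, Finset.mem_sdiff, Finset.mem_product, Finset.mem_range] at hc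
  by_cases hi : i = ℓ
  · exact ⟨j, by omega, Subtype.ext (Prod.ext (by simp only [box]; omega)
      (by simp only [box]; omega))⟩
  · exact ⟨k + (ℓ - i), by omega, Subtype.ext (Prod.ext (by simp only [box]; omega)
      (by simp only [box]; omega))⟩

theorem box_injective {p q : ℕ} (hp : p ≤ k + ℓ) (hq : q ≤ k + ℓ) (h : box k ℓ p = box k ℓ q) :
    p = q := by
  have h1 := congrArg (fun c : antiHook k ℓ => c.1.1) h
  have h2 := congrArg (fun c : antiHook k ℓ => c.1.2) h
  simp only [box] at h1 h2
  omega

theorem rowWeakColStrict_iff (g : antiHook k ℓ → ℕ+) :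
    RowWeakColStrict g Finset.univ ↔
      (∀ j, j < k → g (box k ℓ j) ≤ g (box k ℓ (j + 1))) ∧
        ∀ j, k ≤ j → j < k + ℓ → g (box k ℓ (j + 1)) < g (box k ℓ j) := by
  constructor
  · intro h
    refine ⟨fun j hj => (h _ (Finset.mem_univ _) _ (Finset.mem_univ _)).1 ?_ ?_,
      fun j hj hj' => (h _ (Finset.mem_univ _) _ (Finset.mem_univ _)).2 ?_ ?_⟩ <;>
      simp only [box] <;> omega
  · rintro ⟨h1, h2⟩
    have h1' : ∀ p q, p ≤ q → q ≤ k → g (box k ℓ p) ≤ g (box k ℓ q) := by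
      intro p q hpq
      induction q, hpq using Nat.le_induction with
      | base => exact fun _ => le_rfl
      | succ q hpq ih => exact fun hq => (ih (by omega)).trans (h1 q (by omega))
    have h2' : ∀ p q, k ≤ p → p + 1 ≤ q → q ≤ k + ℓ → g (box k ℓ q) < g (box k ℓ p) := by
      intro p q hp hpq
      induction q, hpq using Nat.le_induction with
      | base => exact fun hq => h2 p hp (by omega)
      | succ q hpq ih => exact fun hq => (h2 q (by omega) (by omega)).trans (ih (by omega))
    intro c _ d _
    obtain ⟨p, hp, rfl⟩ := exists_box c
    obtain ⟨q, hq, rfl⟩ := exists_box d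
    simp only [box]
    refine ⟨fun h3 h4 => h1' p q (by omega) (by omega), fun h3 h4 => ?_⟩
    exact h2' q p (by omega) (by omega) hp

/-- The condition on fillings that corresponds to the `i`-th product. -/
def SplitAt (i : ℕ) (g : antiHook k ℓ → ℕ+) : Prop :=
  Chain 0 (fun a : Fin i => g (box k ℓ a)) ∧
    Chain 1 (fun a : Fin (ℓ + k - i + 1) => g (box k ℓ (k + ℓ - a)))

theorem splitAt_iff {i : ℕ} (g : antiHook k ℓ → ℕ+) :
    SplitAt i g ↔ (∀ j, j + 1 < i → g (box k ℓ j) ≤ g (box k ℓ (j + 1))) ∧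
      ∀ j, i ≤ j → j < k + ℓ → g (box k ℓ (j + 1)) < g (box k ℓ j) := by
  rw [SplitAt, chain_iff_succ, chain_iff_succ]
  refine and_congr Iff.rfl ⟨fun h j hj hj' => ?_, fun h j hj => ?_⟩
  · have h1 := h (k + ℓ - (j + 1)) (by omega)
    rw [show k + ℓ - (k + ℓ - (j + 1)) = j + 1 by omega,
      show k + ℓ - (k + ℓ - (j + 1) + 1) = j by omega] at h1
    exact_mod_cast h1
  · have h1 := h (k + ℓ - (j + 1)) (by omega) (by omega)
    rw [show k + ℓ - (j + 1) + 1 = k + ℓ - j by omega] at h1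
    exact_mod_cast h1

open Classical in
theorem sum_splitAt (g : antiHook k ℓ → ℕ+) :
    ∑ i : Fin (k + 1), (-1 : ℂ) ^ (k - (i : ℕ)) * (if SplitAt i g then 1 else 0) =
      if RowWeakColStrict g Finset.univ then 1 else 0 := by
  -- `up i` says that the path increases weakly up to box `i` and decreases strictly afterwards.
  -- `SplitAt (i + 1)` leaves the comparison of boxes `i` and `i + 1` open, so it is the disjoint
  -- union of `up (i + 1)` and `up i`. Since `SplitAt 0` is `up 0`, the alternating sum collapses to
  -- `up k`, the semistandard condition.
  set up : ℕ → Prop := fun i => (∀ j, j < i → g (box k ℓ j) ≤ g (box k ℓ (j + 1))) ∧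
    ∀ j, i ≤ j → j < k + ℓ → g (box k ℓ (j + 1)) < g (box k ℓ j) with hup
  have hrec : ∀ i, i + 1 ≤ k → (if SplitAt (i + 1) g then (1 : ℂ) else 0) =
      (if up (i + 1) then 1 else 0) + if up i then 1 else 0 := by
    intro i hi
    have h1 : up (i + 1) ↔ SplitAt (i + 1) g ∧ g (box k ℓ i) ≤ g (box k ℓ (i + 1)) := by
      rw [splitAt_iff]
      constructor
      · rintro ⟨h1, h2⟩
        exact ⟨⟨fun j hj => h1 j (by omega), h2⟩, h1 i (by omega)⟩
      · rintro ⟨⟨h1, h2⟩, h3⟩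
        refine ⟨fun j hj => ?_, h2⟩
        rcases Nat.lt_succ_iff_lt_or_eq.1 hj with hj | rfl
        · exact h1 j (by omega)
        · exact h3
    have h2 : up i ↔ SplitAt (i + 1) g ∧ ¬ g (box k ℓ i) ≤ g (box k ℓ (i + 1)) := by
      rw [splitAt_iff, not_le]
      constructor
      · rintro ⟨h1, h2⟩
        exact ⟨⟨fun j hj => h1 j (by omega), fun j hj => h2 j (by omega)⟩,
          h2 i le_rfl (by omega)⟩
      · rintro ⟨⟨h1, h2⟩, h3⟩
        refine ⟨fun j hj => h1 j (by omega), fun j hj hj' => ?_⟩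
        rcases hj.eq_or_lt with rfl | hj
        · exact h3
        · exact h2 j hj hj'
    by_cases h3 : SplitAt (i + 1) g <;>
      by_cases h4 : g (box k ℓ i) ≤ g (box k ℓ (i + 1)) <;> simp [h1, h2, h3, h4]
  have key : ∀ i, i ≤ k → ∑ j ∈ Finset.range (i + 1),
      (-1 : ℂ) ^ (i - j) * (if SplitAt j g then 1 else 0) = if up i then 1 else 0 := by
    intro i
    induction i with
    | zero =>
      intro _
      have : SplitAt 0 g ↔ up 0 := by rw [splitAt_iff]; simp [hup]
      simp only [zero_add, Finset.sum_range_one, Nat.sub_self, pow_zero, one_mul, this]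
    | succ i ih =>
      intro hi
      rw [Finset.sum_range_succ, Nat.sub_self, pow_zero, one_mul, hrec i hi]
      have h1 : ∑ j ∈ Finset.range (i + 1), (-1 : ℂ) ^ (i + 1 - j) *
          (if SplitAt j g then 1 else 0) = -∑ j ∈ Finset.range (i + 1),
            (-1 : ℂ) ^ (i - j) * (if SplitAt j g then 1 else 0) := by
        rw [← Finset.sum_neg_distrib]
        refine Finset.sum_congr rfl fun j hj => ?_
        rw [Nat.succ_sub (Nat.lt_succ_iff.1 (Finset.mem_range.1 hj)), pow_succ]
        ring
      rw [h1, ih (by omega)]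
      ring
  rw [Fin.sum_univ_eq_sum_range (fun i => (-1 : ℂ) ^ (k - i) * (if SplitAt i g then 1 else 0)),
    key k le_rfl]
  simp only [rowWeakColStrict_iff, hup]

theorem starArg_apply (s : antiHook k ℓ → ℂ) (i : Fin (k + 1)) (a : Fin (i : ℕ)) :
    starArg s i a = s (box k ℓ a) := by
  rw [starArg, rowEntry]
  congr 1
  refine Subtype.ext (Prod.ext ?_ ?_) <;> simp only [box] <;> omega

theorem ezArg_apply (s : antiHook k ℓ → ℂ) (i : Fin (k + 1)) (a : Fin (ℓ + k - i + 1)) :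
    ezArg s i a = s (box k ℓ (k + ℓ - a)) := by
  rw [ezArg]
  split_ifs with h
  · rw [colEntry]
    congr 1
    refine Subtype.ext (Prod.ext ?_ ?_) <;> simp only [box] <;> omega
  · rw [rowEntry]
    congr 1
    refine Subtype.ext (Prod.ext ?_ ?_) <;> simp only [box] <;> omega

theorem bijective_box (i : Fin (k + 1)) : Function.Bijective
    (Sum.elim (fun a : Fin (i : ℕ) => box k ℓ a)
      (fun a : Fin (ℓ + k - i + 1) => box k ℓ (k + ℓ - a))) := by
  constructor
  · rintro (a | a) (b | b) h <;> simp only [Sum.elim_inl, Sum.elim_inr] at h <;>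
      have h' := box_injective (by omega) (by omega) h
    · exact congrArg Sum.inl (Fin.ext h')
    · omega
    · omega
    · exact congrArg Sum.inr (Fin.ext (by omega))
  · intro c
    obtain ⟨p, hp, rfl⟩ := exists_box c
    by_cases h : p < i
    · exact ⟨Sum.inl ⟨p, h⟩, rfl⟩
    · refine ⟨Sum.inr ⟨k + ℓ - p, by omega⟩, ?_⟩
      simp only [Sum.elim_inr]
      congr 1
      omega

open Classical in
theorem zetaEZStar_mul_zetaEZ (i : Fin (k + 1)) {s : antiHook k ℓ → ℂ} (hs : ∀ c, 2 < (s c).re) :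
    zetaEZStar i (starArg s i) * zetaEZ (ℓ + k - i + 1) (ezArg s i) =
      ∑' g : antiHook k ℓ → ℕ+, if SplitAt i g then fillTerm s g else 0 := by
  have h1 : starArg s i ∈ convDomain i := mem_convDomain_of_one_lt fun a => by
    rw [starArg_apply]; linarith [hs (box k ℓ a)]
  have h2 : ezArg s i ∈ convDomain (ℓ + k - i + 1) := mem_convDomain_of_one_lt fun a => by
    rw [ezArg_apply]; linarith [hs (box k ℓ (k + ℓ - a))]
  rw [zetaEZStar_eq, zetaEZ_eq, (chain_continuation zero_le_one _).1.2 h1,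
    (chain_continuation le_rfl _).1.2 h2, chainSeries, chainSeries,
    tsum_mul_tsum_of_summable_norm (summable_and_analyticAt_chain 0 h1).1
      (summable_and_analyticAt_chain 1 h2).1]
  -- The two index tuples together visit each box once, so pairs of tuples are the same as fillings.
  set E := Equiv.ofBijective _ (bijective_box (ℓ := ℓ) i) with hE
  rw [← ((Equiv.arrowCongr E.symm (Equiv.refl ℕ+)).trans
    (Equiv.sumArrowEquivProdArrow _ _ _)).tsum_eq]
  refine tsum_congr fun g => ?_
  have h3 : fillTerm s g = term (starArg s i) (fun a => g (box k ℓ a)) *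
      term (ezArg s i) (fun a => g (box k ℓ (k + ℓ - a))) := by
    rw [fillTerm, ← E.prod_comp, Fintype.prod_sum_type, term, term]
    congr 1
    · exact Finset.prod_congr rfl fun a _ => by rw [starArg_apply]; rfl
    · exact Finset.prod_congr rfl fun a _ => by rw [ezArg_apply]; rfl
  change (if Chain 0 (fun a : Fin (i : ℕ) => g (box k ℓ a)) then
      term (starArg s i) (fun a => g (box k ℓ a)) else 0) *
    (if Chain 1 (fun a : Fin (ℓ + k - i + 1) => g (box k ℓ (k + ℓ - a))) then
      term (ezArg s i) (fun a => g (box k ℓ (k + ℓ - a))) else 0) = _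
  rw [h3, SplitAt]
  split_ifs <;> simp_all

open Classical in
theorem antiHookSum_eq_tsum {s : antiHook k ℓ → ℂ} (hs : ∀ c, 2 < (s c).re) :
    antiHookSum s =
      ∑' g : antiHook k ℓ → ℕ+, if RowWeakColStrict g Finset.univ then fillTerm s g else 0 := by
  rw [antiHookSum]
  calc _ = ∑ i : Fin (k + 1), ∑' g : antiHook k ℓ → ℕ+,
        (-1 : ℂ) ^ (k - (i : ℕ)) * (if SplitAt i g then fillTerm s g else 0) := by
        refine Finset.sum_congr rfl fun i _ => ?_
        rw [mul_assoc, zetaEZStar_mul_zetaEZ i hs, tsum_mul_left]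
    _ = ∑' g : antiHook k ℓ → ℕ+, ∑ i : Fin (k + 1),
        (-1 : ℂ) ^ (k - (i : ℕ)) * (if SplitAt i g then fillTerm s g else 0) :=
        (Summable.tsum_finsetSum fun i _ => (summable_ite_fillTerm hs _).mul_left _).symm
    _ = _ := by
        refine tsum_congr fun g => ?_
        have h := congrArg (fun z => fillTerm s g * z) (sum_splitAt g)
        simp only [Finset.mul_sum, mul_ite, mul_one, mul_zero] at h ⊢
        rw [← h]
        refine Finset.sum_congr rfl fun i _ => ?_
        split_ifs <;> ring

/-! ### The identities on the whole space -/

theorem analyticAt_blockSums {θ : Finset (ℕ × ℕ)} {m : ℕ} (w : Fin m → Finset θ) (z : θ → ℂ) :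
    AnalyticAt ℂ (fun s => blockSums s w) z := by
  refine AnalyticAt.pi fun a => Finset.analyticAt_fun_sum _ fun c _ => ?_
  exact (ContinuousLinearMap.proj (R := ℂ) (φ := fun _ : θ => ℂ) c).analyticAt z

theorem isOpen_two_lt_re (ι : Type*) [Finite ι] : IsOpen {s : ι → ℂ | ∀ c, 2 < (s c).re} := by
  simp only [ofPred_forall]
  exact isOpen_iInter_of_finite fun c =>
    isOpen_lt continuous_const (Complex.continuous_re.comp (continuous_apply c))

theorem three_mem_two_lt_re (ι : Type*) : (fun _ => 3) ∈ {s : ι → ℂ | ∀ c, 2 < (s c).re} := by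
  intro c
  norm_num

open Classical in
theorem isEntireQuotient_sumPreceq {e : ℕ} (he : e ≤ 1) {E : Type*} [NormedAddCommGroup E]
    [NormedSpace ℂ E] {θ : Finset (ℕ × ℕ)} {L : E → θ → ℂ} (hL : ∀ z, AnalyticAt ℂ L z)
    (h3 : ∃ z, ∀ c, 2 < (L z c).re) (x : ℕ → ℂ) : IsEntireQuotient (fun z =>
      sumPreceq (L z) (fun m t => x m * continuation (convDomain m) (chainSeries e m) t)) := by
  unfold sumPreceq
  refine IsEntireQuotient.sum _ fun m _ => IsEntireQuotient.sum _ fun w hw => ?_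
  obtain ⟨z, hz⟩ := h3
  refine (IsEntireQuotient.const _).mul (isEntireQuotient_chain he
    (fun z => AnalyticAt.fun_comp (analyticAt_blockSums w _) (hL z)) ⟨z, ?_⟩)
  exact blockSums_mem_convDomain (Finset.mem_filter.1 hw).2 hz

open Classical in
theorem continuousAt_sumPreceq {e : ℕ} {E : Type*} [NormedAddCommGroup E]
    [NormedSpace ℂ E] {θ : Finset (ℕ × ℕ)} {L : E → θ → ℂ} {s : E} (hL : AnalyticAt ℂ L s)
    (hs : ∀ (m : ℕ) (w : Fin m → Finset θ), Preceq θ m w →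
      AnalyticAt ℂ (continuation (convDomain m) (chainSeries e m)) (blockSums (L s) w))
    (x : ℕ → ℂ) : ContinuousAt (fun z =>
      sumPreceq (L z) (fun m t => x m * continuation (convDomain m) (chainSeries e m) t)) s := by
  unfold sumPreceq
  refine AnalyticAt.continuousAt (𝕜 := ℂ) (Finset.analyticAt_fun_sum _ fun m _ =>
    Finset.analyticAt_fun_sum _ fun w hw => analyticAt_const.mul ?_)
  exact AnalyticAt.fun_comp (hs m w (Finset.mem_filter.1 hw).2)
    (AnalyticAt.fun_comp (analyticAt_blockSums w _) hL)

theorem analyticAt_starArg (i : Fin (k + 1)) (z : antiHook k ℓ → ℂ) :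
    AnalyticAt ℂ (fun s => starArg s i) z :=
  AnalyticAt.pi fun _ =>
    (ContinuousLinearMap.proj (R := ℂ) (φ := fun _ : antiHook k ℓ => ℂ) _).analyticAt z

theorem analyticAt_ezArg (i : Fin (k + 1)) (z : antiHook k ℓ → ℂ) :
    AnalyticAt ℂ (fun s => ezArg s i) z := by
  refine AnalyticAt.pi fun a => ?_
  simp only [ezArg_apply]
  exact (ContinuousLinearMap.proj (R := ℂ) (φ := fun _ : antiHook k ℓ => ℂ) _).analyticAt z

theorem isEntireQuotient_antiHookSum :
    IsEntireQuotient (fun s : antiHook k ℓ → ℂ => antiHookSum s) := by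
  unfold antiHookSum
  simp only [zetaEZ_eq, zetaEZStar_eq]
  refine IsEntireQuotient.sum _ fun i _ => ((IsEntireQuotient.const _).mul
    (isEntireQuotient_chain zero_le_one (analyticAt_starArg i) ⟨fun _ => 3, ?_⟩)).mul
    (isEntireQuotient_chain le_rfl (analyticAt_ezArg i) ⟨fun _ => 3, ?_⟩)
  · exact mem_convDomain_of_one_lt fun a => by rw [starArg_apply]; norm_num
  · exact mem_convDomain_of_one_lt fun a => by rw [ezArg_apply]; norm_num

theorem continuousAt_antiHookSum {s : antiHook k ℓ → ℂ} (hs : AntiHookSumRegular s) :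
    ContinuousAt (fun s : antiHook k ℓ → ℂ => antiHookSum s) s := by
  unfold antiHookSum
  refine AnalyticAt.continuousAt (𝕜 := ℂ) (Finset.analyticAt_fun_sum _ fun i _ =>
    (analyticAt_const.mul ?_).mul ?_)
  · exact AnalyticAt.fun_comp (hs i).1 (analyticAt_starArg i s)
  · exact AnalyticAt.fun_comp (hs i).2 (analyticAt_ezArg i s)

/-- An identity with `antiHookSum` extends from the region of convergence to all points at which
the functions in it are holomorphic. -/
theorem sumPreceq_eq_antiHookSum {e : ℕ} (he : e ≤ 1) {θ : Finset (ℕ × ℕ)}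
    {L : (antiHook k ℓ → ℂ) → θ → ℂ} (hL : ∀ z, AnalyticAt ℂ L z)
    (hL2 : ∀ z, (∀ c, 2 < (z c).re) → ∀ c, 2 < (L z c).re) (x : ℕ → ℂ)
    (heq : ∀ z : antiHook k ℓ → ℂ, (∀ c, 2 < (z c).re) →
      sumPreceq (L z) (fun m t => x m * continuation (convDomain m) (chainSeries e m) t) =
        antiHookSum z)
    {s : antiHook k ℓ → ℂ} (hs : AntiHookSumRegular s)
    (hs' : ∀ (m : ℕ) (w : Fin m → Finset θ), Preceq θ m w →
      AnalyticAt ℂ (continuation (convDomain m) (chainSeries e m)) (blockSums (L s) w)) :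
    sumPreceq (L s) (fun m t => x m * continuation (convDomain m) (chainSeries e m) t) =
      antiHookSum s := by
  have h3 : ∃ z : antiHook k ℓ → ℂ, ∀ c, 2 < (L z c).re :=
    ⟨fun _ => 3, hL2 _ (three_mem_two_lt_re _)⟩
  have h1 := (isEntireQuotient_sumPreceq he hL h3 x).add
    ((IsEntireQuotient.const (-1)).mul isEntireQuotient_antiHookSum)
  have h2 := h1.eq_zero (isOpen_two_lt_re _) ⟨_, three_mem_two_lt_re _⟩
    (fun z hz => by rw [heq z hz]; ring) (s := s)
    ((continuousAt_sumPreceq (hL s) hs' x).add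
      (continuousAt_const.mul (continuousAt_antiHookSum hs)))
  linear_combination h2

theorem sumPreceq_transpose {s : antiHook k ℓ → ℂ} (hs : ∀ c, 2 < (s c).re) :
    sumPreceq (transpose s) (fun m t => (-1) ^ ((antiHook k ℓ).card - m) * zetaEZStar m t) =
      antiHookSum s := by
  have h := sumPreceq_zetaEZStar (s := transpose s) fun c => hs _
  rw [show (transposeDiagram (antiHook k ℓ)).card = (antiHook k ℓ).card from
    Finset.card_map _] at h
  rw [h, tsum_rowStrictColWeak_transpose, antiHookSum_eq_tsum hs]

end SchurZeta

open SchurZeta in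
theorem mainTheorem6 (k ℓ : ℕ) (hk : 1 ≤ k) (hℓ : 1 ≤ ℓ) :
    (∀ r : ℕ, ∀ s ∈ convDomain r,
      Summable (fun m : {m : Fin r → ℕ+ // StrictMono m} => ‖term s m.1‖) ∧
      Summable (fun m : {m : Fin r → ℕ+ // Monotone m} => ‖term s m.1‖)) ∧
    (∀ r : ℕ,
      IsMeromorphicContinuation (convDomain r) (ezSeries r) (zetaEZ r) ∧
      IsMeromorphicContinuation (convDomain r) (ezStarSeries r) (zetaEZStar r)) ∧
    (∀ s : antiHook k ℓ → ℂ, AntiHookSumRegular s →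
      (∀ (m : ℕ) (w : Fin m → Finset (antiHook k ℓ)), Preceq (antiHook k ℓ) m w →
        AnalyticAt ℂ (zetaEZ m) (blockSums s w)) →
      sumPreceq s (fun m t => zetaEZ m t) = antiHookSum s) ∧
    (∀ s : antiHook k ℓ → ℂ, AntiHookSumRegular s →
      (∀ (m : ℕ) (w : Fin m → Finset (transposeDiagram (antiHook k ℓ))),
        Preceq (transposeDiagram (antiHook k ℓ)) m w →
        AnalyticAt ℂ (zetaEZStar m) (blockSums (transpose s) w)) →
      sumPreceq (transpose s)
        (fun m t => (-1) ^ ((antiHook k ℓ).card - m) * zetaEZStar m t) = antiHookSum s) := by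
  refine ⟨fun r s hs => summable_norm_term hs, isMeromorphicContinuation_zeta, fun s hs h => ?_,
    fun s hs h => ?_⟩
  · have key := sumPreceq_eq_antiHookSum (k := k) (ℓ := ℓ) (e := 1) le_rfl (L := fun s => s)
      (fun z => analyticAt_id) (fun z hz => hz) (fun _ => 1)
      (fun z hz => by
        simp only [one_mul, ← zetaEZ_eq]
        rw [sumPreceq_zetaEZ hz, antiHookSum_eq_tsum hz]) hs
      (fun m w hw => by rw [← zetaEZ_eq]; exact h m w hw)
    simpa only [one_mul, ← zetaEZ_eq] using key
  · have key := sumPreceq_eq_antiHookSum (k := k) (ℓ := ℓ) (e := 0) zero_le_one (L := transpose)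
      (fun z => AnalyticAt.pi fun c =>
        (ContinuousLinearMap.proj (R := ℂ) (φ := fun _ : antiHook k ℓ => ℂ) _).analyticAt z)
      (fun z hz c => hz _) (fun m => (-1) ^ ((antiHook k ℓ).card - m))
      (fun z hz => by
        simp only [← zetaEZStar_eq]
        exact sumPreceq_transpose hz) hs
      (fun m w hw => by rw [← zetaEZStar_eq]; exact h m w hw)
    simpa only [← zetaEZStar_eq] using key
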